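/- Let $\mathbb{K}$ be a field of characteristic $0$ and let $G$ be a filtered group, i.e. a group with a descending chain of subgroups $G=F_1G\supset F_2G\supset\cdots$ such that $[F_iG,F_jG]\subset F_{i+j}G$ for all $i,j\ge 1$. Let $\operatorname{Gr}G=\bigoplus_{i\ge1}F_iG/F_{i+1}G$ be the associated graded Lie ring, with bracket induced by commutators in $G$. Filter the group algebra by letting $F_i\mathbb{K}[G]$ ($i\ge 0$) be the $\mathbb{K}$-span of all products $(g_1-1)\cdots(g_r-1)$ with $r\ge 0$, $g_s\in F_{k_s}G$ and $k_1+\cdots+k_r\ge i$. Let $\widehat{\mathbb{K}}[G]=\varprojlim_i\mathbb{K}[G]/F_i\mathbb{K}[G]$, filtered by $F_j\widehat{\mathbb{K}}[G]=\varprojlim_{i\ge j}F_j\mathbb{K}[G]/F_i\mathbb{K}[G]$, let $\iota:G\to\widehat{\mathbb{K}}[G]$ be the canonical map, and let $\widehat\Delta:\widehat{\mathbb{K}}[G]\to\widehat{\mathbb{K}}[G]\widehat\otimes\widehat{\mathbb{K}}[G]$ be the coproduct induced by $g\mapsto g\otimes g$, where $\widehat\otimes$ is the completion of the tensor product with respect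 to $F_n(V\otimes W)=\sum_{i+j=n}F_iV\otimes F_jW$. The Malcev Lie algebra of $G$ is the Lie algebra of primitive elements $$\mathfrak{m}(G)=\{x\in\widehat{\mathbb{K}}[G]:\widehat\Delta x=x\,\widehat\otimes\,1+1\,\widehat\otimes\,x\},$$ with the commutator bracket, filtered by $F_i\,\mathfrak{m}(G)=\mathfrak{m}(G)\cap F_i\widehat{\mathbb{K}}[G]$ for $i\ge1$; let $\operatorname{Gr}\mathfrak{m}(G)=\bigoplus_{i\ge1}F_i\,\mathfrak{m}(G)/F_{i+1}\,\mathfrak{m}(G)$. Then $\log\iota(g)=\sum_{k\ge1}\frac{(-1)^{k+1}}{k}(\iota(g)-1)^k$ lies in $\mathfrak{m}(G)$ for every $g\in G$, and in $F_i\,\mathfrak{m}(G)$ for every $g\in F_iG$, and the map $\log\iota:G\to\mathfrak{m}(G)$ induces an isomorphism of graded Lie algebras over $\mathbb{K}$ $$\operatorname{Gr}G\otimes_{\mathbb{Z}}\mathbb{K}\;\xrightarrow{\ \cong\ }\;\operatorname{Gr}\mathfrak{m}(G),\qquad \{g\}\otimes 1\mapsto\{\log\iota(g)\}\quad(g\in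 F_iG,\ i\ge1).$$ -/

import Mathlib

open scoped DirectSum TensorProduct commutatorElement

attribute [local instance] LieRing.ofAssociativeRing

/-- A filtration (N-series) of a group: a chain `G = F_1 G ⊇ F_2 G ⊇ ⋯` of subgroups such that
`[F_i G, F_j G] ⊆ F_{i+j} G`. -/
structure GroupFiltration (G : Type*) [Group G] where
  F : ℕ+ → Subgroup G
  one : F 1 = ⊤
  antitone : Antitone F
  commutator_le : ∀ i j, ⁅F i, F j⁆ ≤ F (i + j)

/-- A family of biadditive brackets on graded pieces indexed by positive integers, subject to the
axioms of a Lie ring; these axioms are stated in the direct sum. -/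
structure GradedBracket (M : ℕ+ → Type*) [∀ i, AddCommGroup (M i)] where
  br : ∀ i j, M i →+ M j →+ M (i + j)
  self : ∀ i x, br i i x x = 0
  skew : ∀ i j x y, DirectSum.of M _ (br i j x y) = - DirectSum.of M _ (br j i y x)
  jacobi : ∀ i j k x y z, DirectSum.of M _ (br (i + j) k (br i j x y) z) +
    DirectSum.of M _ (br (j + k) i (br j k y z) x) +
    DirectSum.of M _ (br (k + i) j (br k i z x) y) = 0

namespace GradedBracket

variable {M : ℕ+ → Type*} [∀ i, AddCommGroup (M i)] (B : GradedBracket M)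

/-- The bracket on the direct sum: the biadditive extension of the brackets of the pieces. -/
def hom : (⨁ i, M i) →+ (⨁ i, M i) →+ ⨁ i, M i :=
  DirectSum.toAddMonoid fun i => AddMonoidHom.flip <| DirectSum.toAddMonoid fun j =>
    AddMonoidHom.flip <| (AddMonoidHom.compHom (DirectSum.of M (i + j))).comp (B.br i j)

theorem hom_of (i j : ℕ+) (x : M i) (y : M j) :
    B.hom (DirectSum.of M i x) (DirectSum.of M j y) = DirectSum.of M (i + j) (B.br i j x y) := by
  simp [hom]

theorem hom_skew (x y : ⨁ i, M i) : B.hom x y = - B.hom y x := by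
  induction x using DirectSum.induction_on with
  | zero => simp
  | add x x' hx hx' => simp only [map_add, AddMonoidHom.add_apply, hx, hx', neg_add]
  | of i x =>
    induction y using DirectSum.induction_on with
    | zero => simp
    | add y y' hy hy' => simp only [map_add, AddMonoidHom.add_apply, hy, hy', neg_add]
    | of j y => simp only [hom_of, B.skew i j]

theorem hom_self (x : ⨁ i, M i) : B.hom x x = 0 := by
  induction x using DirectSum.induction_on with
  | zero => simp
  | of i x => rw [hom_of, B.self, map_zero]
  | add x y hx hy =>
    simp only [map_add, AddMonoidHom.add_apply, hx, hy]
    rw [B.hom_skew x y]; simp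

theorem hom_jacobi (x y z : ⨁ i, M i) :
    B.hom (B.hom x y) z + B.hom (B.hom y z) x + B.hom (B.hom z x) y = 0 := by
  induction x using DirectSum.induction_on with
  | zero => simp
  | add x x' hx hx' =>
    rw [← add_zero (0 : ⨁ i, M i)]
    nth_rewrite 1 [← hx]
    rw [← hx']
    simp only [map_add, AddMonoidHom.add_apply]
    abel
  | of i x =>
    induction y using DirectSum.induction_on with
    | zero => simp
    | add y y' hy hy' =>
      rw [← add_zero (0 : ⨁ i, M i)]
      nth_rewrite 1 [← hy]
      rw [← hy']
      simp only [map_add, AddMonoidHom.add_apply]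
      abel
    | of j y =>
      induction z using DirectSum.induction_on with
      | zero => simp
      | add z z' hz hz' =>
        rw [← add_zero (0 : ⨁ i, M i)]
        nth_rewrite 1 [← hz]
        rw [← hz']
        simp only [map_add, AddMonoidHom.add_apply]
        abel
      | of k z => simp only [hom_of, B.jacobi i j k]

theorem hom_leibniz (x y z : ⨁ i, M i) :
    B.hom x (B.hom y z) = B.hom (B.hom x y) z + B.hom y (B.hom x z) := by
  have h := B.hom_jacobi x y z
  rw [B.hom_skew x (B.hom y z), B.hom_skew y (B.hom x z), B.hom_skew x z, map_neg,
    AddMonoidHom.neg_apply, neg_neg, ← sub_eq_zero, ← neg_eq_zero, ← h]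
  abel

/-- The Lie ring structure on the direct sum. -/
@[reducible] def lieRing : LieRing (⨁ i, M i) where
  bracket x y := B.hom x y
  add_lie x y z := by simp
  lie_add x y z := by simp
  lie_self := B.hom_self
  leibniz_lie := B.hom_leibniz

end GradedBracket

namespace GroupFiltration

variable {G : Type*} [Group G] (Φ : GroupFiltration G)

theorem comm_mem {i j : ℕ+} {x y : G} (hx : x ∈ Φ.F i) (hy : y ∈ Φ.F j) : ⁅x, y⁆ ∈ Φ.F (i + j) :=
  Φ.commutator_le i j (Subgroup.commutator_mem_commutator hx hy)

instance normal (i : ℕ+) : (Φ.F i).Normal := by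
  refine ⟨fun n hn g => ?_⟩
  have h1 : ⁅g, n⁆ ∈ Φ.F i :=
    Φ.antitone (PNat.lt_add_left i 1).le (Φ.comm_mem (by rw [Φ.one]; trivial) hn)
  have : g * n * g⁻¹ = ⁅g, n⁆ * n := by simp [commutatorElement_def]
  rw [this]; exact mul_mem h1 hn

/-- The quotient group `F_i G / F_{i+1} G`, written multiplicatively. -/
abbrev Quot (i : ℕ+) : Type _ := Φ.F i ⧸ (Φ.F (i + 1)).subgroupOf (Φ.F i)

instance (i : ℕ+) : CommGroup (Φ.Quot i) where
  mul_comm := by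
    rintro ⟨x⟩ ⟨y⟩
    refine QuotientGroup.eq.mpr ?_
    rw [Subgroup.mem_subgroupOf]
    have h := Φ.antitone (add_le_add_right (one_le (a := i)) i) (Φ.comm_mem (inv_mem y.2) (inv_mem x.2))
    simpa [commutatorElement_def, mul_assoc] using h

/-- The degree `i` piece `F_i G / F_{i+1} G` of `Gr G`, written additively. -/
abbrev Piece (i : ℕ+) : Type _ := Additive (Φ.Quot i)

/-- The class `{x}` in `F_i G / F_{i+1} G` of an element `x` of `F_i G`. -/
def cls (i : ℕ+) (x : G) (hx : x ∈ Φ.F i) : Φ.Piece i :=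
  Additive.ofMul (QuotientGroup.mk ⟨x, hx⟩)

theorem cls_surj {i : ℕ+} (a : Φ.Piece i) : ∃ x hx, a = Φ.cls i x hx := by
  obtain ⟨x, hx⟩ := QuotientGroup.mk_surjective a.toMul
  exact ⟨x.1, x.2, (congrArg Additive.ofMul hx).symm⟩

theorem cls_eq {i : ℕ+} {x y : G} {hx : x ∈ Φ.F i} {hy : y ∈ Φ.F i}
    (h : x⁻¹ * y ∈ Φ.F (i + 1)) : Φ.cls i x hx = Φ.cls i y hy :=
  congrArg Additive.ofMul (QuotientGroup.eq.mpr (by rwa [Subgroup.mem_subgroupOf]))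

theorem cls_add {i : ℕ+} {x y : G} (hx : x ∈ Φ.F i) (hy : y ∈ Φ.F i) :
    Φ.cls i x hx + Φ.cls i y hy = Φ.cls i (x * y) (mul_mem hx hy) := rfl

theorem cls_neg {i : ℕ+} {x : G} (hx : x ∈ Φ.F i) :
    - Φ.cls i x hx = Φ.cls i x⁻¹ (inv_mem hx) := rfl

theorem cls_one {i : ℕ+} : Φ.cls i 1 (one_mem _) = 0 := rfl

theorem cls_conj {i : ℕ+} {x : G} (g : G) (hx : x ∈ Φ.F i) (hx' : g * x * g⁻¹ ∈ Φ.F i) :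
    Φ.cls i (g * x * g⁻¹) hx' = Φ.cls i x hx := by
  symm
  apply Φ.cls_eq
  have h := Φ.comm_mem (inv_mem hx) (show g ∈ Φ.F 1 by rw [Φ.one]; trivial)
  simpa [commutatorElement_def, mul_assoc] using h

theorem of_cls_congr {i j : ℕ+} {x y : G} {hx : x ∈ Φ.F i} {hy : y ∈ Φ.F j} (hij : i = j)
    (hxy : x = y) : DirectSum.of Φ.Piece i (Φ.cls i x hx) = DirectSum.of Φ.Piece j (Φ.cls j y hy) := by
  subst hij hxy; rfl

theorem comm_left_mul {i j : ℕ+} {x y z : G} (hx : x ∈ Φ.F i) (hy : y ∈ Φ.F i) (hz : z ∈ Φ.F j) :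
    Φ.cls (i + j) ⁅x * y, z⁆ (Φ.comm_mem (mul_mem hx hy) hz) =
      Φ.cls (i + j) ⁅x, z⁆ (Φ.comm_mem hx hz) + Φ.cls (i + j) ⁅y, z⁆ (Φ.comm_mem hy hz) := by
  have h : x * ⁅y, z⁆ * x⁻¹ ∈ Φ.F (i + j) := (Φ.normal _).conj_mem _ (Φ.comm_mem hy hz) x
  rw [← Φ.cls_conj x (Φ.comm_mem hy hz) h, add_comm (Φ.cls _ _ _), cls_add]
  congr 1
  simp [commutatorElement_def, mul_assoc]

theorem comm_right_mul {i j : ℕ+} {x y z : G} (hx : x ∈ Φ.F i) (hy : y ∈ Φ.F j) (hz : z ∈ Φ.F j) :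
    Φ.cls (i + j) ⁅x, y * z⁆ (Φ.comm_mem hx (mul_mem hy hz)) =
      Φ.cls (i + j) ⁅x, y⁆ (Φ.comm_mem hx hy) + Φ.cls (i + j) ⁅x, z⁆ (Φ.comm_mem hx hz) := by
  have h : y * ⁅x, z⁆ * y⁻¹ ∈ Φ.F (i + j) := (Φ.normal _).conj_mem _ (Φ.comm_mem hx hz) y
  rw [← Φ.cls_conj y (Φ.comm_mem hx hz) h, cls_add]
  congr 1
  simp [commutatorElement_def, mul_assoc]

/-- For `x ∈ F_i G`, the map `{y} ↦ {[x, y]}`. -/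
def brRight (i j : ℕ+) (x : Φ.F i) : Φ.Piece j →+ Φ.Piece (i + j) :=
  MonoidHom.toAdditive <| QuotientGroup.lift _
    (MonoidHom.mk' (fun y : Φ.F j =>
        (QuotientGroup.mk ⟨⁅x.1, y.1⁆, Φ.comm_mem x.2 y.2⟩ : Φ.Quot (i + j)))
      fun y z => Φ.comm_right_mul x.2 y.2 z.2)
    fun _ hy => (QuotientGroup.eq_one_iff _).mpr (Φ.comm_mem (j := j + 1) x.2 hy)

/-- The bracket `{x}, {y} ↦ {[x, y]}` induced by the commutators of `G`. -/
def br (i j : ℕ+) : Φ.Piece i →+ Φ.Piece j →+ Φ.Piece (i + j) :=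
  MonoidHom.toAdditiveLeft <| QuotientGroup.lift _
    (MonoidHom.mk' (fun x : Φ.F i => Multiplicative.ofAdd (Φ.brRight i j x)) fun x y => by
      refine AddMonoidHom.ext fun a => ?_
      obtain ⟨z, hz, rfl⟩ := Φ.cls_surj a
      exact Φ.comm_left_mul x.2 y.2 hz)
    fun x hx => by
      refine AddMonoidHom.ext fun a => ?_
      obtain ⟨z, hz, rfl⟩ := Φ.cls_surj a
      refine congrArg Additive.ofMul ((QuotientGroup.eq_one_iff _).mpr ?_)
      rw [Subgroup.mem_subgroupOf]
      have := Φ.comm_mem (i := i + 1) hx hz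
      rwa [add_right_comm] at this

theorem br_cls {i j : ℕ+} {x y : G} (hx : x ∈ Φ.F i) (hy : y ∈ Φ.F j) :
    Φ.br i j (Φ.cls i x hx) (Φ.cls j y hy) = Φ.cls (i + j) ⁅x, y⁆ (Φ.comm_mem hx hy) := rfl

theorem br_skew (i j : ℕ+) (a : Φ.Piece i) (b : Φ.Piece j) :
    DirectSum.of Φ.Piece _ (Φ.br i j a b) = - DirectSum.of Φ.Piece _ (Φ.br j i b a) := by
  obtain ⟨x, hx, rfl⟩ := Φ.cls_surj a
  obtain ⟨y, hy, rfl⟩ := Φ.cls_surj b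
  rw [← map_neg, br_cls, br_cls, cls_neg]
  exact Φ.of_cls_congr (add_comm _ _) (by simp)

theorem br_br_cls {i j k : ℕ+} {x y z : G} (hx : x ∈ Φ.F i) (hy : y ∈ Φ.F j) (hz : z ∈ Φ.F k) :
    Φ.br (i + j) k (Φ.br i j (Φ.cls i x hx) (Φ.cls j y hy)) (Φ.cls k z hz) =
      Φ.cls (i + j + k) ⁅⁅x, y⁆, y * z * y⁻¹⁆
        (Φ.comm_mem (Φ.comm_mem hx hy) ((Φ.normal k).conj_mem _ hz y)) := by
  rw [← Φ.cls_conj y hz ((Φ.normal k).conj_mem _ hz y)]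
  rfl

theorem br_jacobi (i j k : ℕ+) (a : Φ.Piece i) (b : Φ.Piece j) (c : Φ.Piece k) :
    DirectSum.of Φ.Piece _ (Φ.br (i + j) k (Φ.br i j a b) c) +
      DirectSum.of Φ.Piece _ (Φ.br (j + k) i (Φ.br j k b c) a) +
      DirectSum.of Φ.Piece _ (Φ.br (k + i) j (Φ.br k i c a) b) = 0 := by
  obtain ⟨x, hx, rfl⟩ := Φ.cls_surj a
  obtain ⟨y, hy, rfl⟩ := Φ.cls_surj b
  obtain ⟨z, hz, rfl⟩ := Φ.cls_surj c
  have h1 : j + k + i = i + j + k := by rw [add_comm, add_assoc]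
  have h2 : k + i + j = i + j + k := by rw [add_assoc, add_comm]
  rw [br_br_cls, br_br_cls, br_br_cls,
    Φ.of_cls_congr (x := ⁅⁅y, z⁆, z * x * z⁻¹⁆) (hy := h1 ▸ Φ.comm_mem (Φ.comm_mem hy hz)
      ((Φ.normal i).conj_mem _ hx z)) h1 rfl,
    Φ.of_cls_congr (x := ⁅⁅z, x⁆, x * y * x⁻¹⁆) (hy := h2 ▸ Φ.comm_mem (Φ.comm_mem hz hx)
      ((Φ.normal j).conj_mem _ hy x)) h2 rfl,
    ← map_add, ← map_add, cls_add, cls_add,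
    Φ.of_cls_congr (hy := one_mem _) rfl (commutatorElement_commutatorElement_conj_mul x y z),
    cls_one, map_zero]

/-- The brackets of `Gr G`. -/
def bracket : GradedBracket Φ.Piece where
  br := Φ.br
  self i a := by
    obtain ⟨x, hx, rfl⟩ := Φ.cls_surj a
    refine congrArg Additive.ofMul ((QuotientGroup.eq_one_iff _).mpr ?_)
    rw [Subgroup.mem_subgroupOf]
    simp
  skew := Φ.br_skew
  jacobi := Φ.br_jacobi

/-- The associated graded Lie ring `Gr G = ⨁_{i ≥ 1} F_i G / F_{i+1} G`. -/
def Gr : Type _ := ⨁ i, Φ.Piece i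

noncomputable instance : LieRing Φ.Gr := Φ.bracket.lieRing

/-- The inclusion of the degree `i` piece into `Gr G`. -/
noncomputable def homogeneous (i : ℕ+) : Φ.Piece i →+ Φ.Gr := DirectSum.of Φ.Piece i

theorem lie_homogeneous {i j : ℕ+} {x y : G} (hx : x ∈ Φ.F i) (hy : y ∈ Φ.F j) :
    ⁅Φ.homogeneous i (Φ.cls i x hx), Φ.homogeneous j (Φ.cls j y hy)⁆ =
      Φ.homogeneous (i + j) (Φ.cls (i + j) ⁅x, y⁆ (Φ.comm_mem hx hy)) :=
  Φ.bracket.hom_of i j _ _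

end GroupFiltration

/-- A filtration of a Lie algebra: a chain `L = F_1 L ⊇ F_2 L ⊇ ⋯` of subspaces such that
`[F_i L, F_j L] ⊆ F_{i+j} L`. -/
structure LieFiltration (K L : Type*) [CommRing K] [LieRing L] [LieAlgebra K L] where
  F : ℕ+ → Submodule K L
  one : F 1 = ⊤
  antitone : Antitone F
  lie_mem : ∀ {i j x y}, x ∈ F i → y ∈ F j → ⁅x, y⁆ ∈ F (i + j)

namespace LieFiltration

variable {K L : Type*} [CommRing K] [LieRing L] [LieAlgebra K L] (Ψ : LieFiltration K L)

/-- The degree `i` piece `F_i L / F_{i+1} L` of `Gr L`. -/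
abbrev Piece (i : ℕ+) : Type _ := Ψ.F i ⧸ (Ψ.F (i + 1)).submoduleOf (Ψ.F i)

/-- The class `{x}` in `F_i L / F_{i+1} L` of an element `x` of `F_i L`. -/
def cls (i : ℕ+) (x : L) (hx : x ∈ Ψ.F i) : Ψ.Piece i := Submodule.Quotient.mk ⟨x, hx⟩

theorem cls_surj {i : ℕ+} (a : Ψ.Piece i) : ∃ x hx, a = Ψ.cls i x hx := by
  obtain ⟨x, hx⟩ := Submodule.Quotient.mk_surjective _ a
  exact ⟨x.1, x.2, hx.symm⟩

theorem cls_add {i : ℕ+} {x y : L} (hx : x ∈ Ψ.F i) (hy : y ∈ Ψ.F i) :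
    Ψ.cls i x hx + Ψ.cls i y hy = Ψ.cls i (x + y) (add_mem hx hy) := rfl

theorem cls_neg {i : ℕ+} {x : L} (hx : x ∈ Ψ.F i) :
    - Ψ.cls i x hx = Ψ.cls i (-x) (neg_mem hx) := rfl

theorem cls_zero {i : ℕ+} : Ψ.cls i 0 (zero_mem _) = 0 := rfl

theorem of_cls_congr {i j : ℕ+} {x y : L} {hx : x ∈ Ψ.F i} {hy : y ∈ Ψ.F j} (hij : i = j)
    (hxy : x = y) : DirectSum.of Ψ.Piece i (Ψ.cls i x hx) = DirectSum.of Ψ.Piece j (Ψ.cls j y hy) := by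
  subst hij hxy; rfl

/-- For `x ∈ F_i L`, the map `{y} ↦ {[x, y]}`. -/
def brRight (i j : ℕ+) (x : Ψ.F i) : Ψ.Piece j →ₗ[K] Ψ.Piece (i + j) :=
  Submodule.mapQ _ _
    ({ toFun := fun y => ⟨⁅x.1, y.1⁆, Ψ.lie_mem x.2 y.2⟩
       map_add' := fun y z => Subtype.ext (lie_add x.1 y.1 z.1)
       map_smul' := fun c y => Subtype.ext (lie_smul c x.1 y.1) } : Ψ.F j →ₗ[K] Ψ.F (i + j))
    fun _ hy => Ψ.lie_mem (j := j + 1) x.2 hy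

/-- The bracket `{x}, {y} ↦ {[x, y]}` induced by the bracket of `L`. -/
def br (i j : ℕ+) : Ψ.Piece i →ₗ[K] Ψ.Piece j →ₗ[K] Ψ.Piece (i + j) :=
  Submodule.liftQ _
    ({ toFun := Ψ.brRight i j
       map_add' := fun x y => by
        refine LinearMap.ext fun a => ?_
        obtain ⟨z, hz, rfl⟩ := Ψ.cls_surj a
        exact congrArg Submodule.Quotient.mk (Subtype.ext (add_lie x.1 y.1 z))
       map_smul' := fun c x => by
        refine LinearMap.ext fun a => ?_
        obtain ⟨z, hz, rfl⟩ := Ψ.cls_surj a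
        exact congrArg Submodule.Quotient.mk (Subtype.ext (smul_lie c x.1 z)) } :
      Ψ.F i →ₗ[K] Ψ.Piece j →ₗ[K] Ψ.Piece (i + j))
    fun x hx => by
      refine LinearMap.mem_ker.mpr (LinearMap.ext fun a => ?_)
      obtain ⟨z, hz, rfl⟩ := Ψ.cls_surj a
      refine (Submodule.Quotient.mk_eq_zero _).mpr ?_
      have := Ψ.lie_mem (i := i + 1) hx hz
      rwa [add_right_comm] at this

theorem br_cls {i j : ℕ+} {x y : L} (hx : x ∈ Ψ.F i) (hy : y ∈ Ψ.F j) :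
    Ψ.br i j (Ψ.cls i x hx) (Ψ.cls j y hy) = Ψ.cls (i + j) ⁅x, y⁆ (Ψ.lie_mem hx hy) := rfl

/-- The brackets of `Gr L`. -/
def bracket : GradedBracket Ψ.Piece where
  br i j := LinearMap.toAddMonoidHom'.comp (Ψ.br i j).toAddMonoidHom
  self i a := by
    obtain ⟨x, hx, rfl⟩ := Ψ.cls_surj a
    refine (Submodule.Quotient.mk_eq_zero _).mpr ?_
    simp [Submodule.submoduleOf]
  skew i j a b := by
    obtain ⟨x, hx, rfl⟩ := Ψ.cls_surj a
    obtain ⟨y, hy, rfl⟩ := Ψ.cls_surj b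
    rw [← map_neg]
    exact Ψ.of_cls_congr (hx := Ψ.lie_mem hx hy) (hy := neg_mem (Ψ.lie_mem hy hx)) (add_comm _ _)
      (lie_skew x y).symm
  jacobi i j k a b c := by
    obtain ⟨x, hx, rfl⟩ := Ψ.cls_surj a
    obtain ⟨y, hy, rfl⟩ := Ψ.cls_surj b
    obtain ⟨z, hz, rfl⟩ := Ψ.cls_surj c
    have h1 : j + k + i = i + j + k := by rw [add_comm, add_assoc]
    have h2 : k + i + j = i + j + k := by rw [add_assoc, add_comm]
    change DirectSum.of Ψ.Piece _ (Ψ.cls (i + j + k) ⁅⁅x, y⁆, z⁆ (Ψ.lie_mem (Ψ.lie_mem hx hy) hz)) +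
      DirectSum.of Ψ.Piece _ (Ψ.cls (j + k + i) ⁅⁅y, z⁆, x⁆ (Ψ.lie_mem (Ψ.lie_mem hy hz) hx)) +
      DirectSum.of Ψ.Piece _ (Ψ.cls (k + i + j) ⁅⁅z, x⁆, y⁆ (Ψ.lie_mem (Ψ.lie_mem hz hx) hy)) = 0
    rw [Ψ.of_cls_congr (x := ⁅⁅y, z⁆, x⁆) (hy := h1 ▸ Ψ.lie_mem (Ψ.lie_mem hy hz) hx) h1 rfl,
      Ψ.of_cls_congr (x := ⁅⁅z, x⁆, y⁆) (hy := h2 ▸ Ψ.lie_mem (Ψ.lie_mem hz hx) hy) h2 rfl,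
      ← map_add, ← map_add, cls_add, cls_add]
    have h : ⁅⁅x, y⁆, z⁆ + ⁅⁅y, z⁆, x⁆ + ⁅⁅z, x⁆, y⁆ = 0 := by
      have := lie_jacobi x y z
      rw [← lie_skew ⁅y, z⁆ x, ← lie_skew ⁅z, x⁆ y, ← lie_skew ⁅x, y⁆ z, ← neg_eq_zero, ← this]
      abel
    rw [Ψ.of_cls_congr (hy := zero_mem _) rfl h, cls_zero, map_zero]

theorem hom_smul (c : K) (x y : ⨁ i, Ψ.Piece i) :
    Ψ.bracket.hom x (c • y) = c • Ψ.bracket.hom x y := by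
  induction x using DirectSum.induction_on with
  | zero => simp
  | add x x' hx hx' => simp only [map_add, AddMonoidHom.add_apply, hx, hx', smul_add]
  | of i x =>
    induction y using DirectSum.induction_on with
    | zero => simp
    | add y y' hy hy' => simp only [map_add, smul_add, hy, hy']
    | of j y =>
      rw [← DirectSum.of_smul, GradedBracket.hom_of, GradedBracket.hom_of, ← DirectSum.of_smul]
      exact congrArg _ (map_smul (Ψ.br i j x) c y)

/-- The associated graded Lie algebra `Gr L = ⨁_{i ≥ 1} F_i L / F_{i+1} L`. -/
def Gr : Type _ := ⨁ i, Ψ.Piece i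

noncomputable instance : LieRing Ψ.Gr := Ψ.bracket.lieRing

noncomputable instance : Module K Ψ.Gr := inferInstanceAs (Module K (⨁ i, Ψ.Piece i))

noncomputable instance : LieAlgebra K Ψ.Gr where
  lie_smul := Ψ.hom_smul

/-- The inclusion of the degree `i` piece into `Gr L`. -/
noncomputable def homogeneous (i : ℕ+) : Ψ.Piece i →ₗ[K] Ψ.Gr := DirectSum.lof K ℕ+ Ψ.Piece i

theorem lie_homogeneous {i j : ℕ+} {x y : L} (hx : x ∈ Ψ.F i) (hy : y ∈ Ψ.F j) :
    ⁅Ψ.homogeneous i (Ψ.cls i x hx), Ψ.homogeneous j (Ψ.cls j y hy)⁆ =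
      Ψ.homogeneous (i + j) (Ψ.cls (i + j) ⁅x, y⁆ (Ψ.lie_mem hx hy)) :=
  Ψ.bracket.hom_of i j _ _

end LieFiltration

/-- A multiplicative filtration of an algebra by subspaces. -/
structure AlgFiltration (K A : Type*) [CommRing K] [Ring A] [Algebra K A] where
  F : ℕ → Submodule K A
  zero : F 0 = ⊤
  antitone : Antitone F
  mul_mem : ∀ {i j a b}, a ∈ F i → b ∈ F j → a * b ∈ F (i + j)

namespace AlgFiltration

section General

variable {K A B : Type*} [CommRing K] [Ring A] [Algebra K A] [Ring B] [Algebra K B]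
variable (Θ : AlgFiltration K A) (Ξ : AlgFiltration K B)

/-- The terms of the filtration are two-sided ideals. -/
def ideal (n : ℕ) : Ideal A where
  carrier := Θ.F n
  add_mem' := add_mem
  zero_mem' := zero_mem _
  smul_mem' a b hb := by
    have := Θ.mul_mem (i := 0) (a := a) (by rw [Θ.zero]; trivial) hb
    rwa [zero_add] at this

theorem mem_ideal {n : ℕ} {a : A} : a ∈ Θ.ideal n ↔ a ∈ Θ.F n := Iff.rfl

instance (n : ℕ) : (Θ.ideal n).IsTwoSided where
  mul_mem_of_left {a} b ha := Θ.mul_mem (j := 0) (b := b) ha (by rw [Θ.zero]; trivial)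

theorem ideal_le {m n : ℕ} (h : m ≤ n) : Θ.ideal n ≤ Θ.ideal m := Θ.antitone h

/-- The completion `lim_n A / F_n A`, as a subalgebra of the product of the `A / F_n A`. -/
def limit : Subalgebra K (∀ n, A ⧸ Θ.ideal n) where
  carrier := {x | ∀ m n (h : m ≤ n), Ideal.Quotient.factorₐ K (Θ.ideal_le h) (x n) = x m}
  mul_mem' hx hy m n h := by simp only [Pi.mul_apply, map_mul, hx m n h, hy m n h]
  add_mem' hx hy m n h := by simp only [Pi.add_apply, map_add, hx m n h, hy m n h]
  algebraMap_mem' c m n h := by simp only [Pi.algebraMap_apply, AlgHom.commutes]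

/-- The completion `lim_n A / F_n A`. -/
def Completion : Type _ := Θ.limit

instance : Ring Θ.Completion := inferInstanceAs (Ring Θ.limit)

instance : Algebra K Θ.Completion := inferInstanceAs (Algebra K Θ.limit)

/-- The projection of the completion to `A / F_n A`. -/
def proj (n : ℕ) : Θ.Completion →ₐ[K] A ⧸ Θ.ideal n :=
  (Pi.evalAlgHom K (fun n => A ⧸ Θ.ideal n) n).comp Θ.limit.val

theorem factor_proj {m n : ℕ} (h : m ≤ n) (x : Θ.Completion) :
    Ideal.Quotient.factorₐ K (Θ.ideal_le h) (Θ.proj n x) = Θ.proj m x := x.2 m n h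

theorem completion_ext {x y : Θ.Completion} (h : ∀ n, Θ.proj n x = Θ.proj n y) : x = y :=
  Subtype.ext (funext h)

/-- The canonical map from `A` to its completion. -/
def toCompletion : A →ₐ[K] Θ.Completion :=
  (AlgHom.pi fun n => Ideal.Quotient.mkₐ K (Θ.ideal n)).codRestrict Θ.limit
    fun _ _ _ _ => rfl

theorem proj_toCompletion (n : ℕ) (a : A) :
    Θ.proj n (Θ.toCompletion a) = Ideal.Quotient.mk (Θ.ideal n) a := rfl

theorem exists_proj (n : ℕ) (x : Θ.Completion) :
    ∃ a : A, ∀ m ≤ n, Θ.proj m x = Ideal.Quotient.mk (Θ.ideal m) a := by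
  obtain ⟨a, ha⟩ := Ideal.Quotient.mk_surjective (Θ.proj n x)
  refine ⟨a, fun m h => ?_⟩
  rw [← Θ.factor_proj h, ← ha]
  rfl

/-- The filtration of the completion: `F_j` is the kernel of the projection to `A / F_j A`, that is
`lim_{i ≥ j} F_j A / F_i A` (see `mem_completed_iff`). -/
def completed : AlgFiltration K Θ.Completion where
  F j := LinearMap.ker (Θ.proj j).toLinearMap
  zero := by
    refine eq_top_iff.mpr fun x _ => ?_
    obtain ⟨a, ha⟩ := Θ.exists_proj 0 x
    have : a ∈ Θ.ideal 0 := by rw [mem_ideal, Θ.zero]; trivial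
    exact (ha 0 le_rfl).trans (Ideal.Quotient.eq_zero_iff_mem.mpr this)
  antitone m n h x hx := by
    change Θ.proj m x = 0
    rw [← Θ.factor_proj h, show Θ.proj n x = 0 from hx, map_zero]
  mul_mem {i j x y} hx hy := by
    obtain ⟨a, ha⟩ := Θ.exists_proj (i + j) x
    obtain ⟨b, hb⟩ := Θ.exists_proj (i + j) y
    have ha' : a ∈ Θ.ideal i := Ideal.Quotient.eq_zero_iff_mem.mp ((ha i (by omega)).symm.trans hx)
    have hb' : b ∈ Θ.ideal j := Ideal.Quotient.eq_zero_iff_mem.mp ((hb j (by omega)).symm.trans hy)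
    change Θ.proj (i + j) (x * y) = 0
    rw [map_mul, ha _ le_rfl, hb _ le_rfl, ← map_mul]
    exact Ideal.Quotient.eq_zero_iff_mem.mpr (Θ.mul_mem ha' hb')

theorem mem_completed {j : ℕ} {x : Θ.Completion} : x ∈ Θ.completed.F j ↔ Θ.proj j x = 0 := Iff.rfl

theorem mem_completed_iff {j : ℕ} {x : Θ.Completion} : x ∈ Θ.completed.F j ↔
    ∀ i, j ≤ i → ∃ a ∈ Θ.F j, Θ.proj i x = Ideal.Quotient.mk (Θ.ideal i) a := by
  rw [mem_completed]
  constructor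
  · intro h i hij
    obtain ⟨a, ha⟩ := Θ.exists_proj i x
    exact ⟨a, Ideal.Quotient.eq_zero_iff_mem.mp ((ha j hij).symm.trans h), ha i le_rfl⟩
  · intro h
    obtain ⟨a, ha, hx⟩ := h j le_rfl
    exact hx.trans (Ideal.Quotient.eq_zero_iff_mem.mpr ha)

theorem toCompletion_mem {n : ℕ} {a : A} (h : a ∈ Θ.F n) : Θ.toCompletion a ∈ Θ.completed.F n :=
  Ideal.Quotient.eq_zero_iff_mem.mpr h

/-- The filtration `F_n (A ⊗ B) = ∑_{i+j=n} F_i A ⊗ F_j B` of the tensor product. -/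
def tensor : AlgFiltration K (A ⊗[K] B) where
  F n := ⨆ p : {p : ℕ × ℕ // p.1 + p.2 = n},
    Submodule.map₂ (TensorProduct.mk K A B) (Θ.F p.1.1) (Ξ.F p.1.2)
  zero := by
    refine eq_top_iff.mpr (le_iSup_of_le ⟨(0, 0), rfl⟩ ?_)
    rw [Θ.zero, Ξ.zero, TensorProduct.map₂_mk_top_top_eq_top]
  antitone := by
    refine antitone_nat_of_succ_le fun n => iSup_le fun ⟨p, hp⟩ => ?_
    rcases Nat.eq_zero_or_pos p.1 with h | h
    · exact le_trans (Submodule.map₂_le_map₂_right (Ξ.antitone (Nat.sub_le p.2 1)))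
        (le_iSup_of_le ⟨(p.1, p.2 - 1), by dsimp only; omega⟩ le_rfl)
    · exact le_trans (Submodule.map₂_le_map₂_left (Θ.antitone (Nat.sub_le p.1 1)))
        (le_iSup_of_le ⟨(p.1 - 1, p.2), by dsimp only; omega⟩ le_rfl)
  mul_mem {i j a b} ha hb := by
    refine (?_ : _ * _ ≤ (_ : Submodule K (A ⊗[K] B))) (Submodule.mul_mem_mul ha hb)
    simp only [Submodule.iSup_mul, Submodule.mul_iSup]
    refine iSup_le fun ⟨p, hp⟩ => iSup_le fun ⟨q, hq⟩ =>
      le_iSup_of_le ⟨(p.1 + q.1, p.2 + q.2), by dsimp only; omega⟩ ?_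
    rw [Submodule.map₂_eq_span_image2, Submodule.map₂_eq_span_image2, Submodule.span_mul_span,
      Submodule.span_le]
    rintro _ ⟨_, ⟨a, ha, b, hb, rfl⟩, _, ⟨c, hc, d, hd, rfl⟩, rfl⟩
    simp only [TensorProduct.mk_apply, Algebra.TensorProduct.tmul_mul_tmul]
    exact Submodule.apply_mem_map₂ _ (add_comm p.1 q.1 ▸ Θ.mul_mem ha hc)
      (add_comm p.2 q.2 ▸ Ξ.mul_mem hb hd)

theorem tmul_mem {i j : ℕ} {a : A} {b : B} (ha : a ∈ Θ.F i) (hb : b ∈ Ξ.F j) :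
    a ⊗ₜ[K] b ∈ (Θ.tensor Ξ).F (i + j) :=
  Submodule.mem_iSup_of_mem ⟨(i, j), rfl⟩ <| Submodule.apply_mem_map₂ _ ha hb

/-- The complete tensor product: the completion of the tensor product. -/
abbrev CompleteTensor : Type _ := (Θ.tensor Ξ).Completion

/-- The extension of a filtered algebra map to the completions. -/
def map (f : A →ₐ[K] B) (hf : ∀ n, ∀ a ∈ Θ.F n, f a ∈ Ξ.F n) : Θ.Completion →ₐ[K] Ξ.Completion :=
  (AlgHom.pi fun n => (Ideal.quotientMapₐ (Ξ.ideal n) f (hf n)).comp (Θ.proj n)).codRestrict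
    Ξ.limit fun x m n h => by
      obtain ⟨a, ha⟩ := Θ.exists_proj n x
      change Ideal.Quotient.factorₐ K _ (Ideal.quotientMapₐ (Ξ.ideal n) f (hf n) (Θ.proj n x)) =
        Ideal.quotientMapₐ (Ξ.ideal m) f (hf m) (Θ.proj m x)
      rw [ha n le_rfl, ha m h]
      rfl

theorem proj_map {f : A →ₐ[K] B} {hf : ∀ n, ∀ a ∈ Θ.F n, f a ∈ Ξ.F n} {n : ℕ} {x : Θ.Completion}
    {a : A} (h : Θ.proj n x = Ideal.Quotient.mk (Θ.ideal n) a) :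
    Ξ.proj n (Θ.map Ξ f hf x) = Ideal.Quotient.mk (Ξ.ideal n) (f a) :=
  congrArg (Ideal.quotientMapₐ (Ξ.ideal n) f (hf n)) h

end General

section Log

variable {K A : Type*} [Field K] [Ring A] [Algebra K A] (Θ : AlgFiltration K A)

theorem pow_mem {x : A} (hx : x ∈ Θ.F 1) (k : ℕ) : x ^ k ∈ Θ.F k := by
  induction k with
  | zero => rw [Θ.zero]; trivial
  | succ k ih => rw [pow_succ]; exact Θ.mul_mem ih hx

/-- The logarithm `∑_{k ≥ 1} (-1)^{k+1} (x - 1)^k / k` of an element `x` of `1 + F_1`. The terms with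
`k ≥ n` vanish in `A / F_n A`. -/
def log (x : Θ.Completion) (hx : x - 1 ∈ Θ.completed.F 1) : Θ.Completion :=
  ⟨fun n => Θ.proj n (∑ k ∈ Finset.Ico 1 n, ((-1) ^ (k + 1) / (k : K)) • (x - 1) ^ k), by
    intro m n h
    change _ = Θ.proj m _
    rw [Θ.factor_proj h, map_sum, map_sum]
    refine (Finset.sum_subset (Finset.Ico_subset_Ico_right h) fun k _ hk' => ?_).symm
    have hk : m ≤ k := by
      simp only [Finset.mem_Ico] at *
      omega
    have hz : Θ.proj m ((x - 1) ^ k) = 0 :=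
      Θ.completed.antitone hk (Θ.completed.pow_mem hx k)
    rw [map_smul, hz, smul_zero]⟩

/-- The logarithm is the limit of the partial sums of its series. -/
theorem log_sub_mem (x : Θ.Completion) (hx : x - 1 ∈ Θ.completed.F 1) (n : ℕ) :
    Θ.log x hx - ∑ k ∈ Finset.Ico 1 n, ((-1) ^ (k + 1) / (k : K)) • (x - 1) ^ k ∈
      Θ.completed.F n := by
  rw [mem_completed, map_sub]
  exact sub_self _

end Log

end AlgFiltration

section Primitives

variable {K A T : Type*} [CommRing K] [Ring A] [Algebra K A] [Ring T] [Algebra K T]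

/-- The elements `x` of an algebra `A` such that `D x = x ⊗ 1 + 1 ⊗ x`, for a coproduct `D` with
values in an algebra `T` that receives `A ⊗ A`. -/
def primitives (D : A →ₐ[K] T) (t : A ⊗[K] A →ₐ[K] T) : LieSubalgebra K A where
  carrier := {x | D x = t (x ⊗ₜ 1 + 1 ⊗ₜ x)}
  add_mem' {x y} hx hy := by
    change D (x + y) = _
    rw [map_add, show D x = _ from hx, show D y = _ from hy, ← map_add, TensorProduct.add_tmul,
      TensorProduct.tmul_add]
    congr 1
    abel
  zero_mem' := by
    change D 0 = _
    simp
  smul_mem' c x hx := by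
    change D (c • x) = _
    rw [map_smul, show D x = _ from hx, ← map_smul, smul_add, TensorProduct.smul_tmul',
      TensorProduct.tmul_smul]
  lie_mem' {x y} hx hy := by
    change D (x * y - y * x) = t ((x * y - y * x) ⊗ₜ 1 + 1 ⊗ₜ (x * y - y * x))
    rw [map_sub, map_mul, map_mul, show D x = _ from hx, show D y = _ from hy, ← map_mul,
      ← map_mul, ← map_sub]
    congr 1
    simp only [mul_add, add_mul, Algebra.TensorProduct.tmul_mul_tmul, one_mul, mul_one,
      TensorProduct.sub_tmul, TensorProduct.tmul_sub]
    abel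

theorem mem_primitives {D : A →ₐ[K] T} {t : A ⊗[K] A →ₐ[K] T} {x : A} :
    x ∈ primitives D t ↔ D x = t (x ⊗ₜ 1 + 1 ⊗ₜ x) := Iff.rfl

end Primitives

noncomputable section

namespace GroupFiltration

variable (K : Type*) [Field K] {G : Type*} [Group G] (Φ : GroupFiltration G)

/-- The products `(g_1 - 1) ⋯ (g_r - 1)` with `g_s ∈ F_{k_s} G` and `k_1 + ⋯ + k_r ≥ i`, the list
being that of the pairs `(k_s, g_s)`. -/
def augProducts (i : ℕ) : Set (MonoidAlgebra K G) :=
  {a | ∃ l : List (ℕ+ × G), (∀ p ∈ l, p.2 ∈ Φ.F p.1) ∧ i ≤ (l.map fun p => (p.1 : ℕ)).sum ∧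
    a = (l.map fun p => MonoidAlgebra.of K G p.2 - 1).prod}

theorem augProducts_anti {m n : ℕ} (h : m ≤ n) : Φ.augProducts K n ⊆ Φ.augProducts K m := by
  rintro a ⟨l, h1, h2, h3⟩
  exact ⟨l, h1, h.trans h2, h3⟩

theorem of_sub_one_mem {k : ℕ+} {g : G} (hg : g ∈ Φ.F k) :
    MonoidAlgebra.of K G g - 1 ∈ Φ.augProducts K k :=
  ⟨[(k, g)], by simpa using hg, by simp, by simp⟩

/-- The filtration of the group algebra induced by the filtration of the group. -/
def groupAlgebra : AlgFiltration K (MonoidAlgebra K G) where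
  F i := Submodule.span K (Φ.augProducts K i)
  zero := by
    have h1 : (1 : MonoidAlgebra K G) ∈ Submodule.span K (Φ.augProducts K 0) :=
      Submodule.subset_span ⟨[], by simp, by simp, by simp⟩
    refine eq_top_iff.mpr fun a _ => ?_
    induction a using MonoidAlgebra.induction_on with
    | of g =>
      have h2 := Submodule.subset_span (R := K) (Φ.augProducts_anti K (Nat.zero_le _)
        (Φ.of_sub_one_mem K (k := 1) (g := g) (by rw [Φ.one]; trivial)))
      simpa using add_mem h2 h1
    | add a b ha hb => exact add_mem (ha trivial) (hb trivial)
    | smul r a ha => exact Submodule.smul_mem _ _ (ha trivial)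
  antitone m n h := Submodule.span_mono (Φ.augProducts_anti K h)
  mul_mem {i j a b} ha hb := by
    have h := Submodule.mul_mem_mul ha hb
    rw [Submodule.span_mul_span] at h
    refine Submodule.span_mono ?_ h
    rintro _ ⟨_, ⟨l, h1, h2, rfl⟩, _, ⟨l', h1', h2', rfl⟩, rfl⟩
    refine ⟨l ++ l', fun p hp => ?_, ?_, by simp⟩
    · rcases List.mem_append.mp hp with hp | hp
      exacts [h1 p hp, h1' p hp]
    · rw [List.map_append, List.sum_append]; omega

/-- The completed group algebra. -/
abbrev CompletedGroupAlgebra : Type _ := (Φ.groupAlgebra K).Completion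

/-- The canonical map from the group to the completed group algebra. -/
def ι : G →* Φ.CompletedGroupAlgebra K :=
  ((Φ.groupAlgebra K).toCompletion : MonoidAlgebra K G →* Φ.CompletedGroupAlgebra K).comp
    (MonoidAlgebra.of K G)

theorem ι_sub_one_mem {k : ℕ+} {g : G} (hg : g ∈ Φ.F k) :
    Φ.ι K g - 1 ∈ (Φ.groupAlgebra K).completed.F k := by
  have := (Φ.groupAlgebra K).toCompletion_mem (Submodule.subset_span (Φ.of_sub_one_mem K hg))
  rwa [map_sub, map_one] at this

/-- The complete tensor square of the completed group algebra. -/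
abbrev CompleteTensorSquare : Type _ :=
  (Φ.groupAlgebra K).completed.CompleteTensor (Φ.groupAlgebra K).completed

/-- The coproduct of the group algebra, followed by the canonical map to the tensor square of the
completed group algebra. -/
def preComul : MonoidAlgebra K G →ₐ[K] Φ.CompletedGroupAlgebra K ⊗[K] Φ.CompletedGroupAlgebra K :=
  (Algebra.TensorProduct.map (Φ.groupAlgebra K).toCompletion (Φ.groupAlgebra K).toCompletion).comp
    (Bialgebra.comulAlgHom K (MonoidAlgebra K G))

theorem preComul_of (g : G) : Φ.preComul K (MonoidAlgebra.of K G g) = Φ.ι K g ⊗ₜ Φ.ι K g := by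
  simp [preComul, ι]

theorem preComul_mem (n : ℕ) (a : MonoidAlgebra K G) (ha : a ∈ (Φ.groupAlgebra K).F n) :
    Φ.preComul K a ∈ ((Φ.groupAlgebra K).completed.tensor (Φ.groupAlgebra K).completed).F n := by
  set T := (Φ.groupAlgebra K).completed.tensor (Φ.groupAlgebra K).completed with hT
  have h1 : ∀ {k : ℕ+} {g : G}, g ∈ Φ.F k →
      Φ.preComul K (MonoidAlgebra.of K G g - 1) ∈ T.F k := by
    intro k g hg
    have hk := Φ.ι_sub_one_mem K hg
    have h0 : ∀ x, x ∈ (Φ.groupAlgebra K).completed.F 0 := fun x => by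
      rw [AlgFiltration.zero]; trivial
    have e : Φ.preComul K (MonoidAlgebra.of K G g - 1) =
        (Φ.ι K g - 1) ⊗ₜ Φ.ι K g + 1 ⊗ₜ (Φ.ι K g - 1) := by
      rw [map_sub, map_one, preComul_of, TensorProduct.sub_tmul, TensorProduct.tmul_sub,
        Algebra.TensorProduct.one_def]
      abel
    rw [e]
    refine add_mem ?_ ?_
    · exact AlgFiltration.tmul_mem _ _ (j := 0) hk (h0 _)
    · have := AlgFiltration.tmul_mem _ _ (i := 0) (h0 1) hk
      rwa [zero_add] at this
  refine (Submodule.span_le.mpr ?_ : (Φ.groupAlgebra K).F n ≤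
    (T.F n).comap (Φ.preComul K).toLinearMap) ha
  rintro _ ⟨l, h2, h3, rfl⟩
  refine T.antitone h3 ?_
  clear h3
  change Φ.preComul K _ ∈ _
  induction l with
  | nil =>
    rw [List.map_nil, List.sum_nil, T.zero]; trivial
  | cons p l ih =>
    rw [List.map_cons, List.map_cons, List.prod_cons, List.sum_cons, map_mul]
    exact T.mul_mem (h1 (h2 p (by simp))) (ih fun q hq => h2 q (by simp [hq]))

/-- The complete coproduct of the completed group algebra: the extension by continuity of the
coproduct `g ↦ g ⊗ g` of the group algebra. -/
def completeComul : Φ.CompletedGroupAlgebra K →ₐ[K] Φ.CompleteTensorSquare K :=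
  (Φ.groupAlgebra K).map _ (Φ.preComul K) (Φ.preComul_mem K)

/-- The Malcev Lie algebra: the primitive elements of the completed group algebra, with the
commutator bracket. -/
def malcevLie : LieSubalgebra K (Φ.CompletedGroupAlgebra K) :=
  primitives (Φ.completeComul K) (AlgFiltration.toCompletion _)

/-- The image of `x ⊗ y` in the complete tensor square. -/
def completeTmul (x y : Φ.CompletedGroupAlgebra K) : Φ.CompleteTensorSquare K :=
  AlgFiltration.toCompletion _ (x ⊗ₜ[K] y)

theorem mem_malcevLie {x : Φ.CompletedGroupAlgebra K} : x ∈ Φ.malcevLie K ↔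
    Φ.completeComul K x = Φ.completeTmul K x 1 + Φ.completeTmul K 1 x := by
  rw [malcevLie, mem_primitives, map_add]; rfl

theorem counit_of_mem {a : MonoidAlgebra K G} (ha : a ∈ (Φ.groupAlgebra K).F 1) :
    Bialgebra.counitAlgHom K (MonoidAlgebra K G) a = 0 := by
  refine (Submodule.span_le.mpr ?_ : (Φ.groupAlgebra K).F 1 ≤
    LinearMap.ker (Bialgebra.counitAlgHom K (MonoidAlgebra K G)).toLinearMap) ha
  rintro _ ⟨l, -, h, rfl⟩
  cases l with
  | nil => simp at h
  | cons p l => simp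

theorem mem_of_counit {a : MonoidAlgebra K G}
    (ha : Bialgebra.counitAlgHom K (MonoidAlgebra K G) a = 0) : a ∈ (Φ.groupAlgebra K).F 1 := by
  have key : a - algebraMap K _ (Bialgebra.counitAlgHom K (MonoidAlgebra K G) a) ∈
      (Φ.groupAlgebra K).F 1 := by
    clear ha
    induction a using MonoidAlgebra.induction_on with
    | of g =>
      have := Submodule.subset_span (R := K)
        (Φ.of_sub_one_mem K (k := 1) (g := g) (by rw [Φ.one]; trivial))
      have e : Bialgebra.counitAlgHom K (MonoidAlgebra K G) (MonoidAlgebra.of K G g) = 1 := by simp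
      rw [e, map_one]
      exact this
    | add a b ha hb =>
      rw [map_add, map_add, add_sub_add_comm]
      exact add_mem ha hb
    | smul r a ha =>
      rw [map_smul, smul_eq_mul, map_mul, ← Algebra.smul_def, ← smul_sub]
      exact Submodule.smul_mem _ _ ha
  rwa [ha, map_zero, sub_zero] at key

/-- The counit of the completed group algebra. -/
def completeCounit : Φ.CompletedGroupAlgebra K →ₐ[K] K :=
  (Ideal.Quotient.liftₐ ((Φ.groupAlgebra K).ideal 1) (Bialgebra.counitAlgHom K _)
    fun _ ha => Φ.counit_of_mem K ha).comp ((Φ.groupAlgebra K).proj 1)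

theorem completeCounit_eq {x : Φ.CompletedGroupAlgebra K} {a : MonoidAlgebra K G}
    (h : (Φ.groupAlgebra K).proj 1 x = Ideal.Quotient.mk _ a) :
    Φ.completeCounit K x = Bialgebra.counitAlgHom K _ a :=
  congrArg (Ideal.Quotient.liftₐ ((Φ.groupAlgebra K).ideal 1) (Bialgebra.counitAlgHom K _)
    fun _ ha => Φ.counit_of_mem K ha) h

theorem mem_iff_completeCounit {x : Φ.CompletedGroupAlgebra K} :
    x ∈ (Φ.groupAlgebra K).completed.F 1 ↔ Φ.completeCounit K x = 0 := by
  obtain ⟨a, ha⟩ := (Φ.groupAlgebra K).exists_proj 1 x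
  rw [Φ.completeCounit_eq K (ha 1 le_rfl), AlgFiltration.mem_completed, ha 1 le_rfl,
    Ideal.Quotient.eq_zero_iff_mem]
  exact ⟨Φ.counit_of_mem K, Φ.mem_of_counit K⟩

/-- The tensor square of the counit. -/
def counitSquare : Φ.CompletedGroupAlgebra K ⊗[K] Φ.CompletedGroupAlgebra K →ₐ[K] K :=
  (Algebra.TensorProduct.lmul' K).comp
    (Algebra.TensorProduct.map (Φ.completeCounit K) (Φ.completeCounit K))

theorem counitSquare_tmul (x y : Φ.CompletedGroupAlgebra K) :
    Φ.counitSquare K (x ⊗ₜ y) = Φ.completeCounit K x * Φ.completeCounit K y := by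
  simp [counitSquare]

theorem counitSquare_of_mem
    {w : Φ.CompletedGroupAlgebra K ⊗[K] Φ.CompletedGroupAlgebra K}
    (hw : w ∈ ((Φ.groupAlgebra K).completed.tensor (Φ.groupAlgebra K).completed).F 1) :
    Φ.counitSquare K w = 0 := by
  refine (iSup_le fun ⟨p, hp⟩ => ?_ :
    ((Φ.groupAlgebra K).completed.tensor (Φ.groupAlgebra K).completed).F 1 ≤
      LinearMap.ker (Φ.counitSquare K).toLinearMap) hw
  refine Submodule.map₂_le.mpr fun x hx y hy => ?_
  change Φ.counitSquare K (x ⊗ₜ y) = 0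
  rw [counitSquare_tmul]
  obtain h | h : p.1 = 1 ∨ p.2 = 1 := by omega
  · have hx' : x ∈ (Φ.groupAlgebra K).completed.F 1 := h ▸ hx
    rw [(Φ.mem_iff_completeCounit K).mp hx', zero_mul]
  · have hy' : y ∈ (Φ.groupAlgebra K).completed.F 1 := h ▸ hy
    rw [(Φ.mem_iff_completeCounit K).mp hy', mul_zero]

theorem counitSquare_preComul (a : MonoidAlgebra K G) :
    Φ.counitSquare K (Φ.preComul K a) = Bialgebra.counitAlgHom K _ a := by
  induction a using MonoidAlgebra.induction_on with
  | of g =>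
    rw [preComul_of, counitSquare_tmul, Φ.completeCounit_eq K (a := MonoidAlgebra.of K G g) rfl]
    simp
  | add a b ha hb => simp only [map_add, ha, hb]
  | smul r a ha => simp only [map_smul, ha]

theorem malcevLie_le {x : Φ.CompletedGroupAlgebra K} (hx : x ∈ Φ.malcevLie K) :
    x ∈ (Φ.groupAlgebra K).completed.F 1 := by
  rw [mem_iff_completeCounit]
  obtain ⟨a, ha⟩ := (Φ.groupAlgebra K).exists_proj 1 x
  have h1 := congrArg (AlgFiltration.proj _ 1) ((Φ.mem_malcevLie K).mp hx)
  have h2 : AlgFiltration.proj _ 1 (Φ.completeComul K x) =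
      Ideal.Quotient.mk _ (Φ.preComul K a) :=
    AlgFiltration.proj_map _ _ (ha 1 le_rfl)
  have h3 : AlgFiltration.proj _ 1 (Φ.completeTmul K x 1 + Φ.completeTmul K 1 x) =
      Ideal.Quotient.mk _ (x ⊗ₜ[K] 1 + 1 ⊗ₜ[K] x) := rfl
  rw [h2, h3, Ideal.Quotient.eq] at h1
  have h4 := Φ.counitSquare_of_mem K h1
  rw [map_sub, map_add, counitSquare_preComul, counitSquare_tmul, counitSquare_tmul, map_one,
    ← Φ.completeCounit_eq K (ha 1 le_rfl)] at h4
  linear_combination -h4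

/-- The filtration of the Malcev Lie algebra by its intersections with the terms of the filtration
of the completed group algebra. -/
def malcevFiltration : LieFiltration K (Φ.malcevLie K) where
  F i := ((Φ.groupAlgebra K).completed.F i).comap (Φ.malcevLie K).toSubmodule.subtype
  one := eq_top_iff.mpr fun x _ => Φ.malcevLie_le K x.2
  antitone i j h := Submodule.comap_mono ((Φ.groupAlgebra K).completed.antitone h)
  lie_mem {i j x y} hx hy := by
    have h1 := (Φ.groupAlgebra K).completed.mul_mem hx hy
    have h2 := (Φ.groupAlgebra K).completed.mul_mem hy hx
    rw [add_comm] at h2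
    exact sub_mem h1 h2

/-- The element `log (ι g)` of the completed group algebra. -/
def logι (g : G) : Φ.CompletedGroupAlgebra K :=
  (Φ.groupAlgebra K).log (Φ.ι K g) (Φ.ι_sub_one_mem K (k := 1) (by rw [Φ.one]; trivial))

/-- The degree `i` part `K ⊗ (F_i G / F_{i+1} G)` of the graded Lie algebra `K ⊗ Gr G`. -/
def scalarGrPart (i : ℕ+) : Submodule K (K ⊗[ℤ] Φ.Gr) :=
  LinearMap.range ((Φ.homogeneous i).toIntLinearMap.baseChange K)

end GroupFiltration

end

/-! ### Extending homomorphisms along cyclic extensions -/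

/-! For g in F_iG the series gives log ι(g) ≡ ι(g) − 1 modulo F_{i+1}. So the degree i map K ⊗
F_iG/F_{i+1}G → Gr_i m(G), read in the completed group algebra modulo F_{i+1}, sends 1 ⊗ {g} to the
class of g − 1. Additivity and compatibility with brackets are then congruences for gh − 1 and [g,h]
− 1. Primitivity of log ι(g) is log(xy) = log x + log y for the commuting elements g ⊗ 1 and 1 ⊗ g.
The substance is bijectivity in each degree, and characteristic 0 enters both halves.

Injectivity. The linear map K[F_iG] → K ⊗ F_iG/F_{i+1}G, g ↦ 1 ⊗ {g}, kills degree i+1 of the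
filtration that F_iG defines on its own group algebra (`tmulCls_of_mem`). It remains to see that
K[G] induces this filtration on K[F_iG] (`mem_of_mapDomain_subtype`). One descends from F_mG to
F_{m+1}G through finitely many cyclic extensions, each generated by a subgroup H and an element x
(`mem_of_mapDomain_mem_of_cyclic`). There the left regular action of H on Q = K[H]/F_n is extended
to the larger group by letting x act as b ↦ (x b x⁻¹)u. Here x^p generates the powers of x lying in
H, and u is a p-th root of x^p in Q, which exists because x^p − 1 is nilpotent in Q and p is
invertible when nonzero. Elements of the k-th step of the group filtration then raise the filtration
of Q by k, so degree n of the big group algebra acts as zero on Q, whereas a in K[H] sends 1 to its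
own class.

Surjectivity. Choose a linear E that acts on Gr_j K[G] as multiplication by j in a range of degrees,
and let Ψ(a) = ∑ S(a')E(a''), a Dynkin operator. Modulo higher degree, Ψ(bg) − Ψ(b) ≡ [Ψ(b), g − 1]
+ k ε(b)(g − 1) for g in F_kG, so Ψ turns products of the g_s − 1 into multiples of nested brackets;
by [h − 1, g − 1] ≡ [h,g] − 1 these are combinations of elements g − 1 (`dynkin_mem_lieSpan`). If a
in F_i is primitive modulo F_{i+1}, then Ψ(a) ≡ ia, and dividing by i shows that a itself is such a
combination (`mem_lieSpan_of_primitive`). -/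

theorem MonoidHom.zpow_apply_of_conj {H V : Type*} [Group H] [Group V] (M : H →* V) (v : V)
    (σ : MulAut H) (hM : ∀ h, M (σ h) = v * M h * v⁻¹) (k : ℤ) (h : H) :
    M ((σ ^ k) h) = (MulAut.conj v ^ k) (M h) := by
  have hM' : ∀ h, M (σ⁻¹ h) = (MulAut.conj v)⁻¹ (M h) := fun h => by
    have := hM (σ⁻¹ h)
    rw [MulAut.apply_inv_self] at this
    rw [this, ← MulAut.conj_apply, MulAut.inv_apply_self]
  induction k using Int.induction_on generalizing h with
  | zero => simp
  | succ k ih => rw [zpow_add_one, MulAut.mul_apply, ih, hM, zpow_add_one]; rfl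
  | pred k ih => rw [zpow_sub_one, MulAut.mul_apply, ih, hM', zpow_sub_one]; rfl

/-- By `hgen`, G is a quotient of the semidirect product of H with ℤ acting through σ. The pair (L,
X) defines a homomorphism on that product, and `hrel` makes it trivial on the kernel. -/
theorem MonoidHom.exists_extension_of_cyclic {H G U : Type*} [Group H] [Group G] [Group U]
    (f : H →* G) (L : H →* U) (x : G) (X : U) (σ : MulAut H)
    (hσ : ∀ h, f (σ h) = x * f h * x⁻¹) (hL : ∀ h, L (σ h) = X * L h * X⁻¹)
    (hgen : ∀ g, ∃ (h : H) (k : ℤ), g = f h * x ^ k)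
    (hrel : ∀ (h : H) (k : ℤ), x ^ k = f h → X ^ k = L h) :
    ∃ ρ : G →* U, (∀ h, ρ (f h) = L h) ∧ ρ x = X := by
  let φ : Multiplicative ℤ →* MulAut H := zpowersHom _ σ
  let π : H ⋊[φ] Multiplicative ℤ →* G := SemidirectProduct.lift f (zpowersHom G x) fun k => by
    ext h
    simpa [φ, zpowersHom_apply] using f.zpow_apply_of_conj x σ hσ k.toAdd h
  let Λ : H ⋊[φ] Multiplicative ℤ →* U := SemidirectProduct.lift L (zpowersHom U X) fun k => by
    ext h
    simpa [φ, zpowersHom_apply] using L.zpow_apply_of_conj X σ hL k.toAdd h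
  have hπ : Function.Surjective π := fun g => by
    obtain ⟨h, k, rfl⟩ := hgen g
    exact ⟨⟨h, Multiplicative.ofAdd k⟩, by simp [π, SemidirectProduct.lift, zpowersHom_apply]⟩
  have hker : π.ker ≤ Λ.ker := by
    rintro ⟨h, k⟩ hk
    have h1 : f h * x ^ k.toAdd = 1 := by
      simpa [π, SemidirectProduct.lift, zpowersHom_apply, MonoidHom.mem_ker] using hk
    have h2 := hrel h⁻¹ k.toAdd (by rw [map_inv]; exact eq_inv_of_mul_eq_one_right h1)
    simp [Λ, SemidirectProduct.lift, zpowersHom_apply, MonoidHom.mem_ker, h2]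
  refine ⟨π.liftOfSurjective hπ ⟨Λ, hker⟩, fun h => ?_, ?_⟩
  · have := π.liftOfRightInverse_comp_apply _ (Function.rightInverse_surjInv hπ) ⟨Λ, hker⟩
      (SemidirectProduct.inl h)
    simpa [π, Λ] using this
  · have := π.liftOfRightInverse_comp_apply _ (Function.rightInverse_surjInv hπ) ⟨Λ, hker⟩
      (SemidirectProduct.inr (Multiplicative.ofAdd 1))
    simpa [π, Λ, zpowersHom_apply] using this

open Polynomial in
/-- A truncated `p`-th root of `1 + X`. -/
theorem Polynomial.exists_root_one_add_X (K : Type*) [Field K] [CharZero K] {p : ℕ} (hp : p ≠ 0)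
    (n : ℕ) : ∃ q : K[X], (X : K[X]) ∣ q - 1 ∧ (X : K[X]) ^ n ∣ q ^ p - (1 + X) := by
  -- With exponent n + 1 the correction c X^(n+1) keeps q ≡ 1 mod X, and its square is divisible by
  -- X^(n+2).
  suffices h : ∀ n, ∃ q : K[X], (X : K[X]) ∣ q - 1 ∧ (X : K[X]) ^ (n + 1) ∣ q ^ p - (1 + X) by
    obtain ⟨q, h1, h2⟩ := h n
    exact ⟨q, h1, (pow_dvd_pow _ n.le_succ).trans h2⟩
  intro n
  induction n with
  | zero => exact ⟨1, by simp, by simp⟩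
  | succ n ih =>
    obtain ⟨q, h1, r, hr⟩ := ih
    obtain ⟨s, hs⟩ := h1
    -- Newton step: as q(0) = 1, adding c X^(n+1) changes the coefficient of X^(n+1) in q^p by pc,
    -- which has to cancel r(0).
    let c : K := - r.coeff 0 / p
    have hp' : (p : K) ≠ 0 := Nat.cast_ne_zero.mpr hp
    refine ⟨q + C c * X ^ (n + 1), ?_, ?_⟩
    · exact ⟨s + C c * X ^ n, by linear_combination hs⟩
    · obtain ⟨t, ht⟩ := Polynomial.powAddExpansion q (C c * X ^ (n + 1)) p
      have h2 : X ∣ r + C (p : K) * q ^ (p - 1) * C c := by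
        rw [X_dvd_iff, coeff_add, coeff_mul_C, coeff_C_mul]
        have hq : (q ^ (p - 1)).coeff 0 = 1 := by
          rw [coeff_zero_eq_eval_zero, eval_pow, ← coeff_zero_eq_eval_zero]
          have : q = 1 + X * s := by linear_combination hs
          simp [this]
        rw [hq]
        simp only [c]
        field_simp
        ring
      obtain ⟨w, hw⟩ := h2
      refine ⟨w + t * C c ^ 2 * X ^ n, ?_⟩
      have hC : (C (p : K) : K[X]) = (p : K[X]) := by simp
      rw [hC] at hw
      rw [ht]
      linear_combination hr + X ^ (n + 1) * hw

/-! ### Filtered actions and unipotent operators -/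

noncomputable section

namespace GroupFiltration

variable (K : Type*) [Field K] {G H : Type*} [Group G] [Group H] (Φ : GroupFiltration G)

/-- The filtration induced on the source of a homomorphism. -/
def comap (f : H →* G) : GroupFiltration H where
  F i := (Φ.F i).comap f
  one := by rw [Φ.one, Subgroup.comap_top]
  antitone i j h := Subgroup.comap_mono (Φ.antitone h)
  commutator_le i j := Subgroup.commutator_le.mpr fun x hx y hy => by
    rw [Subgroup.mem_comap, map_commutatorElement]
    exact Φ.comm_mem hx hy

/-- F_n is spanned by products of factors g − 1 of total weight at least n, and each factor raises
`N` by its weight. -/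
theorem lift_apply_mem {M : Type*} [AddCommGroup M] [Module K M] {N : ℕ → Submodule K M}
    (hN : Antitone N) {ρ : G →* Module.End K M}
    (hρ : ∀ (k : ℕ+) (g : G), g ∈ Φ.F k → ∀ j, ∀ a ∈ N j, ρ g a - a ∈ N (j + k))
    {n : ℕ} {w : MonoidAlgebra K G} (hw : w ∈ (Φ.groupAlgebra K).F n) {j : ℕ} {a : M}
    (ha : a ∈ N j) : MonoidAlgebra.lift K _ G ρ w a ∈ N (j + n) := by
  refine (Submodule.span_le.mpr ?_ : (Φ.groupAlgebra K).F n ≤ (N (j + n)).comap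
    ((LinearMap.applyₗ a).comp (MonoidAlgebra.lift K _ G ρ).toLinearMap)) hw
  rintro _ ⟨l, h1, h2, rfl⟩
  refine hN (Nat.add_le_add_left h2 j) ?_
  clear h2
  change MonoidAlgebra.lift K _ G ρ _ a ∈ _
  induction l with
  | nil => simpa using ha
  | cons p l ih =>
    have := hρ p.1 p.2 (h1 p (by simp)) _ _ (ih fun q hq => h1 q (by simp [hq]))
    simp only [List.map_cons, List.prod_cons, List.sum_cons, map_mul, Module.End.mul_apply,
      map_sub, map_one, MonoidAlgebra.lift_of, LinearMap.sub_apply, Module.End.one_apply]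
    rwa [add_comm (p.1 : ℕ), ← add_assoc]

theorem mapDomainAlgHom_of (f : H →* G) (h : H) :
    MonoidAlgebra.mapDomainAlgHom K K f (MonoidAlgebra.of K H h) = MonoidAlgebra.of K G (f h) := by
  simp

/-- An endomorphism of a filtered group that shifts the filtration by `m` up to commutators does so
on the group algebra. -/
theorem mapDomain_sub_mem {σ : G →* G} {m : ℕ}
    (hσ : ∀ (k : ℕ+) (g : G), g ∈ Φ.F k → MonoidAlgebra.of K G (σ g) - MonoidAlgebra.of K G g ∈
      (Φ.groupAlgebra K).F (k + m))
    {n : ℕ} {a : MonoidAlgebra K G} (ha : a ∈ (Φ.groupAlgebra K).F n) :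
    MonoidAlgebra.mapDomainAlgHom K K σ a - a ∈ (Φ.groupAlgebra K).F (n + m) := by
  set Θ := Φ.groupAlgebra K with hΘ
  refine (Submodule.span_le.mpr ?_ : Θ.F n ≤ (Θ.F (n + m)).comap
    ((MonoidAlgebra.mapDomainAlgHom K K σ).toLinearMap - LinearMap.id)) ha
  rintro _ ⟨l, h1, h2, rfl⟩
  refine Θ.antitone (Nat.add_le_add_right h2 m) ?_
  change MonoidAlgebra.mapDomainAlgHom K K σ (l.map fun p => MonoidAlgebra.of K G p.2 - 1).prod -
    (l.map fun p => MonoidAlgebra.of K G p.2 - 1).prod ∈ _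
  clear h2
  induction l with
  | nil => simp
  | cons p l ih =>
    have h3 := hσ p.1 p.2 (h1 p (by simp))
    have h4 := ih fun q hq => h1 q (by simp [hq])
    have h5 : (l.map fun p => MonoidAlgebra.of K G p.2 - 1).prod ∈
        Θ.F (l.map fun p => (p.1 : ℕ)).sum :=
      Submodule.subset_span ⟨l, fun q hq => h1 q (by simp [hq]), le_rfl, rfl⟩
    have h6 : MonoidAlgebra.of K G p.2 - 1 ∈ Θ.F p.1 :=
      Submodule.subset_span (Φ.of_sub_one_mem K (h1 p (by simp)))
    rw [List.map_cons, List.map_cons, List.prod_cons, List.sum_cons, map_mul, map_sub, map_one,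
      mapDomainAlgHom_of]
    set P := (l.map fun p => MonoidAlgebra.of K G p.2 - 1).prod
    have h7 : MonoidAlgebra.mapDomainAlgHom K K σ P ∈ Θ.F (l.map fun p => (p.1 : ℕ)).sum := by
      have := add_mem (Θ.antitone (Nat.le_add_right _ _) h4) h5
      rwa [sub_add_cancel] at this
    -- Twisted Leibniz rule for σ − 1: the shift by m falls on one factor at a time.
    have e : (MonoidAlgebra.of K G (σ p.2) - 1) * MonoidAlgebra.mapDomainAlgHom K K σ P -
        (MonoidAlgebra.of K G p.2 - 1) * P =
        (MonoidAlgebra.of K G (σ p.2) - MonoidAlgebra.of K G p.2) *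
          MonoidAlgebra.mapDomainAlgHom K K σ P +
        (MonoidAlgebra.of K G p.2 - 1) * (MonoidAlgebra.mapDomainAlgHom K K σ P - P) := by
      noncomm_ring
    rw [e]
    refine add_mem ?_ ?_
    · have := Θ.mul_mem h3 h7
      rwa [add_right_comm] at this
    · have := Θ.mul_mem h6 h4
      rwa [← add_assoc] at this

end GroupFiltration

namespace AlgFiltration

variable {K A : Type*} [CommRing K] [Ring A] [Algebra K A] (Θ : AlgFiltration K A)

/-- The filtration induced on the quotient by the `n`-th term. -/
def quot (n : ℕ) : AlgFiltration K (A ⧸ Θ.ideal n) where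
  F j := (Θ.F j).map (Ideal.Quotient.mkₐ K (Θ.ideal n)).toLinearMap
  zero := by
    rw [Θ.zero, Submodule.map_top, LinearMap.range_eq_top]
    exact Ideal.Quotient.mkₐ_surjective K _
  antitone i j h := Submodule.map_mono (Θ.antitone h)
  mul_mem := by
    rintro i j _ _ ⟨a, ha, rfl⟩ ⟨b, hb, rfl⟩
    exact ⟨a * b, Θ.mul_mem ha hb, map_mul (Ideal.Quotient.mkₐ K _) a b⟩

theorem mk_mem_quot {n j : ℕ} {a : A} (ha : a ∈ Θ.F j) :
    Ideal.Quotient.mk (Θ.ideal n) a ∈ (Θ.quot n).F j := ⟨a, ha, rfl⟩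

theorem quot_eq_bot (n : ℕ) : (Θ.quot n).F n = ⊥ := by
  refine eq_bot_iff.mpr ?_
  rintro _ ⟨a, ha, rfl⟩
  exact Ideal.Quotient.eq_zero_iff_mem.mpr ha

/-- The invertible endomorphisms that are trivial modulo a shift by `m`. -/
def unipotent (n m : ℕ) (hm : m ≠ 0) (hn : Θ.F n = ⊥) : Subgroup (Module.End K A)ˣ where
  carrier := {U | ∀ j, ∀ a ∈ Θ.F j, U.1 a - a ∈ Θ.F (j + m)}
  one_mem' j a _ := by simp
  mul_mem' {U V} hU hV j a ha := by
    have h1 := hV j a ha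
    have h2 := hU j _ (by
      have := add_mem (Θ.antitone (Nat.le_add_right j m) h1) ha
      rwa [sub_add_cancel] at this)
    have := add_mem h2 h1
    rwa [sub_add_sub_cancel] at this
  inv_mem' {U} hU := by
    have e : ∀ a, U⁻¹.1 (U.1 a) = a := fun a => by
      rw [← Module.End.mul_apply, ← Units.val_mul, inv_mul_cancel]; rfl
    -- Descending induction on j, starting where F_j = 0: U⁻¹ preserves F_j because U⁻¹a = a −
    -- U⁻¹(Ua − a) and Ua − a lies in the deeper term F_{j+m}.
    have key : ∀ d j, n ≤ j + d → ∀ a ∈ Θ.F j, U⁻¹.1 a ∈ Θ.F j := by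
      intro d
      induction d with
      | zero =>
        intro j hj a ha
        have : a = 0 := by
          have := Θ.antitone hj ha
          rwa [hn, Submodule.mem_bot] at this
        rw [this, map_zero]
        exact zero_mem _
      | succ d ih =>
        intro j hj a ha
        have h1 := Θ.antitone (Nat.le_add_right j m) (ih (j + m) (by omega) _ (hU j a ha))
        have := sub_mem ha h1
        rwa [map_sub, e, sub_sub_cancel] at this
    intro j a ha
    have := neg_mem (key n (j + m) (by omega) _ (hU j a ha))
    rwa [map_sub, e, neg_sub] at this

end AlgFiltration

end

/-! ### Strictness for one cyclic extension -/

noncomputable section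

namespace AlgFiltration

variable {K A : Type*} [Field K] [CharZero K] [Ring A] [Algebra K A] (Θ : AlgFiltration K A)

open Polynomial in
/-- In a nilpotent filtered algebra, unipotent elements have `p`-th roots that are polynomials in
them. -/
theorem exists_root {n m p : ℕ} (hm : m ≠ 0) (hn : Θ.F n = ⊥) (hp : p ≠ 0) {y : A}
    (hy : y - 1 ∈ Θ.F m) : ∃ q : K[X], aeval (y - 1) q ^ p = y ∧ aeval (y - 1) q - 1 ∈ Θ.F m := by
  obtain ⟨q, ⟨s, hs⟩, ⟨t, ht⟩⟩ := Polynomial.exists_root_one_add_X K hp n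
  refine ⟨q, ?_, ?_⟩
  · have h1 : (y - 1) ^ n = 0 := by
      have := Θ.pow_mem (Θ.antitone (Nat.one_le_iff_ne_zero.mpr hm) hy) n
      rwa [hn, Submodule.mem_bot] at this
    have := congrArg (aeval (y - 1)) ht
    simp only [map_sub, map_pow, map_add, map_one, aeval_X, map_mul, h1, zero_mul] at this
    rw [sub_eq_zero.mp this]; abel
  · have := congrArg (aeval (y - 1)) hs
    simp only [map_sub, map_one, aeval_X, map_mul] at this
    rw [this]
    exact Θ.mul_mem (j := 0) hy (by rw [Θ.zero]; trivial)

end AlgFiltration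

namespace GroupFiltration

variable (K : Type*) [Field K] {G H : Type*} [Group G] [Group H]
  (Φ : GroupFiltration G)

theorem exists_conj_equiv (f : H →* G) (hf : Function.Injective f) [f.range.Normal] (x : G) :
    ∃ σ : MulAut H, ∀ h, f (σ h) = x * f h * x⁻¹ := by
  let e := f.ofInjective hf
  refine ⟨(e.trans (MulAut.conjNormal x)).trans e.symm, fun h => ?_⟩
  have h1 : ∀ y : f.range, f (e.symm y) = y := fun y => by
    rw [← MonoidHom.ofInjective_apply hf, MulEquiv.apply_symm_apply]
  simp only [MulEquiv.trans_apply, h1]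
  rw [MulAut.conjNormal_apply]
  rfl

/-- Conjugation by an element of `F_m G` shifts the filtration of the group algebra by `m`. -/
theorem conj_sub_mem {f : H →* G} {m : ℕ+} {x : G} (hx : x ∈ Φ.F m) {σ : H →* H}
    (hσ : ∀ h, f (σ h) = x * f h * x⁻¹) {n : ℕ} {a : MonoidAlgebra K H}
    (ha : a ∈ ((Φ.comap f).groupAlgebra K).F n) :
    MonoidAlgebra.mapDomainAlgHom K K σ a - a ∈ ((Φ.comap f).groupAlgebra K).F (n + m) := by
  refine (Φ.comap f).mapDomain_sub_mem K (fun k h hh => ?_) ha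
  -- Under f, σ(h)h⁻¹ becomes the commutator [x, f(h)], and σ(h) − h = (σ(h)h⁻¹ − 1)h.
  have h1 : σ h * h⁻¹ ∈ (Φ.comap f).F (m + k) := by
    change f (σ h * h⁻¹) ∈ Φ.F (m + k)
    rw [map_mul, map_inv, hσ, ← commutatorElement_def]
    exact Φ.comm_mem hx hh
  have h2 := ((Φ.comap f).groupAlgebra K).mul_mem (j := 0) (b := MonoidAlgebra.of K H h)
    (Submodule.subset_span ((Φ.comap f).of_sub_one_mem K h1))
    (by rw [AlgFiltration.zero]; trivial)
  rw [sub_mul, one_mul, ← map_mul, inv_mul_cancel_right] at h2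
  rwa [add_comm (k : ℕ)]

open Polynomial in
/-- A cyclic extension inside one step of the filtration is strict for the filtrations of the group
algebras. -/
theorem mem_of_mapDomain_mem_of_cyclic [CharZero K] {f : H →* G} (hf : Function.Injective f) {m : ℕ+}
    (htop : Φ.F m = ⊤) (hrange : Φ.F (m + 1) ≤ f.range) (x : G)
    (hgen : ∀ g, ∃ (h : H) (k : ℤ), g = f h * x ^ k) {n : ℕ} {a : MonoidAlgebra K H}
    (ha : MonoidAlgebra.mapDomainAlgHom K K f a ∈ (Φ.groupAlgebra K).F n) :
    a ∈ ((Φ.comap f).groupAlgebra K).F n := by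
  have mem_top : ∀ g, g ∈ Φ.F m := fun g => htop ▸ Subgroup.mem_top g
  -- All of G is F_m, so commutators lie in F_{2m}, hence in F_{m+1}, hence in the range.
  have hnormal : f.range.Normal := ⟨fun y hy g => by
    have h1 : ⁅g, y⁆ ∈ f.range := hrange <| Φ.antitone (add_le_add_right (one_le (a := m)) m)
      (Φ.comm_mem (mem_top g) (mem_top y))
    have : g * y * g⁻¹ = ⁅g, y⁆ * y := by simp [commutatorElement_def]
    rw [this]
    exact mul_mem h1 hy⟩
  obtain ⟨σ, hσ⟩ := exists_conj_equiv f hf x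
  set Θ := (Φ.comap f).groupAlgebra K with hΘ
  set Ξ := Θ.quot n
  have hΞ : Ξ.F n = ⊥ := Θ.quot_eq_bot n
  let η : H →* MonoidAlgebra K H ⧸ Θ.ideal n :=
    ((Ideal.Quotient.mkₐ K (Θ.ideal n)) : _ →* _).comp (MonoidAlgebra.of K H)
  have hη : ∀ (k : ℕ+) h, f h ∈ Φ.F k → η h - 1 ∈ Ξ.F k := fun k h hh => by
    have := Θ.mk_mem_quot (n := n)
      (Submodule.subset_span ((Φ.comap f).of_sub_one_mem K (k := k) (g := h) hh))
    rwa [map_sub, map_one] at this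
  -- conjugation on the quotient
  have hσΘ : ∀ j, ∀ b ∈ Θ.F j, MonoidAlgebra.mapDomainAlgHom K K σ.toMonoidHom b ∈ Θ.F j :=
    fun j b hb => by
      have := add_mem (Θ.antitone (Nat.le_add_right _ _)
        (Φ.conj_sub_mem K (σ := σ.toMonoidHom) (mem_top x) hσ hb)) hb
      rwa [sub_add_cancel] at this
  let s : (MonoidAlgebra K H ⧸ Θ.ideal n) →ₐ[K] (MonoidAlgebra K H ⧸ Θ.ideal n) :=
    Ideal.quotientMapₐ (Θ.ideal n) (MonoidAlgebra.mapDomainAlgHom K K σ.toMonoidHom) (hσΘ n)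
  have s_mk : ∀ b, s (Ideal.Quotient.mk _ b) =
    Ideal.Quotient.mk _ (MonoidAlgebra.mapDomainAlgHom K K σ.toMonoidHom b) := fun _ => rfl
  have s_η : ∀ h, s (η h) = η (σ h) := fun h =>
    (s_mk _).trans (congrArg _ (mapDomainAlgHom_of K σ.toMonoidHom h))
  have s_sub : ∀ j, ∀ b ∈ Ξ.F j, s b - b ∈ Ξ.F (j + m) := by
    rintro j _ ⟨b, hb, rfl⟩
    have := Θ.mk_mem_quot (n := n) (Φ.conj_sub_mem K (σ := σ.toMonoidHom) (mem_top x) hσ hb)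
    rwa [map_sub] at this
  -- the exponents of `x` that lie in the range, and the root
  obtain ⟨p, hp⟩ : ∃ p : ℕ, ∀ k : ℤ, x ^ k ∈ f.range ↔ (p : ℤ) ∣ k := by
    let S : AddSubgroup ℤ := (f.range.comap (zpowersHom G x)).toAddSubgroup'
    obtain ⟨b, hb⟩ := Int.subgroup_cyclic S
    refine ⟨b.natAbs, fun k => ?_⟩
    have h1 : k ∈ S ↔ x ^ k ∈ f.range := Iff.rfl
    rw [← h1, hb, ← AddSubgroup.zmultiples_eq_closure, Int.mem_zmultiples_iff, Int.natAbs_dvd]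
  obtain ⟨y, hy⟩ : x ^ p ∈ f.range := by
    have := (hp p).mpr dvd_rfl
    rwa [zpow_natCast] at this
  have σy : σ y = y := hf (by rw [hσ, hy, (Commute.refl x).pow_right p |>.eq, mul_inv_cancel_right])
  -- Left multiplication by x would be xb = σ(b)x; since x is not available in the quotient, the
  -- last factor is replaced by a p-th root u of the class of y = x^p. As a polynomial in that
  -- class, u is fixed by `s`, because σ y = y. If p = 0, no nonzero power of x lies in H, and u = 1
  -- works.
  obtain ⟨u, hu, hu1, su⟩ : ∃ u, u ^ p = η y ∧ u - 1 ∈ Ξ.F m ∧ s u = u := by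
    rcases eq_or_ne p 0 with h0 | h0
    · refine ⟨1, ?_, by simp, map_one s⟩
      have : y = 1 := hf (by rw [hy, h0, pow_zero, map_one])
      rw [this, map_one, one_pow]
    · obtain ⟨q, h1, h2⟩ := Ξ.exists_root m.ne_zero hΞ h0 (hη m y (mem_top _))
      refine ⟨_, h1, h2, ?_⟩
      rw [← Polynomial.aeval_algHom_apply, map_sub, s_η, σy, map_one]
  -- the action of `x`
  let X : Module.End K (MonoidAlgebra K H ⧸ Θ.ideal n) := (LinearMap.mulRight K u).comp s.toLinearMap
  have X_sub : ∀ j, ∀ b ∈ Ξ.F j, X b - b ∈ Ξ.F (j + m) := fun j b hb => by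
    have h1 := s_sub j b hb
    have h2 : s b ∈ Ξ.F j := by
      have := add_mem (Ξ.antitone (Nat.le_add_right _ _) h1) hb
      rwa [sub_add_cancel] at this
    have h3 := add_mem (Ξ.mul_mem h2 hu1) h1
    rwa [mul_sub, mul_one, sub_add_sub_cancel] at h3
  obtain ⟨V, hV⟩ : IsUnit X := by
    -- X − 1 raises the filtration by m ≥ 1 at each application, and F_n of the quotient is zero.
    have h1 : IsNilpotent (X - 1) := ⟨n, by
      have : ∀ k j, ∀ b ∈ Ξ.F j, ((X - 1) ^ k) b ∈ Ξ.F (j + k) := by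
        intro k
        induction k with
        | zero => intro j b hb; simpa using hb
        | succ k ih =>
          intro j b hb
          rw [pow_succ, Module.End.mul_apply]
          have := ih _ _ (X_sub j b hb)
          exact Ξ.antitone (by have := m.pos; omega) this
      refine LinearMap.ext fun b => ?_
      have := this n 0 b (by rw [Ξ.zero]; trivial)
      rwa [zero_add, hΞ, Submodule.mem_bot] at this⟩
    simpa using h1.isUnit_add_one
  have hV_apply : ∀ b, V.1 b = s b * u := fun b => by rw [hV]; rfl
  let L : H →* (Module.End K (MonoidAlgebra K H ⧸ Θ.ideal n))ˣ :=
    (((Algebra.lmul K (MonoidAlgebra K H ⧸ Θ.ideal n)) : _ →* _).comp η).toHomUnits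
  have L_apply : ∀ h b, (L h).1 b = η h * b := fun _ _ => rfl
  have hLV : ∀ h, L (σ h) = V * L h * V⁻¹ := fun h => by
    rw [eq_mul_inv_iff_mul_eq]
    refine Units.ext (LinearMap.ext fun b => ?_)
    rw [Units.val_mul, Units.val_mul, Module.End.mul_apply, Module.End.mul_apply, L_apply, L_apply,
      hV_apply, hV_apply, map_mul, s_η, mul_assoc]
  -- Since u is fixed by s, V^p(b) = s^p(b)u^p; as σ^p is conjugation by y, this equals s^p(b)η(y) =
  -- η(y)b.
  have hVp : V ^ p = L y := by
    have h1 : ∀ k b, (V ^ k).1 b = (s ^ k) b * u ^ k := by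
      intro k
      induction k with
      | zero => intro b; simp
      | succ k ih =>
        intro b
        rw [pow_succ', Units.val_mul, Module.End.mul_apply, ih, hV_apply, map_mul, map_pow, su,
          mul_assoc, ← pow_succ, pow_succ' s k]
        rfl
    have h2 : ∀ k h, (s ^ k) (η h) = η ((σ ^ k) h) := by
      intro k
      induction k with
      | zero => intro h; simp
      | succ k ih => intro h; rw [pow_succ', AlgHom.mul_apply, ih, s_η, pow_succ']; rfl
    have h3 : ∀ k h, f ((σ ^ k) h) = x ^ k * f h * (x ^ k)⁻¹ := fun k h => by
      have := f.zpow_apply_of_conj x σ hσ k h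
      simpa [← map_pow] using this
    refine Units.ext (LinearMap.ext fun b => ?_)
    rw [h1, L_apply, hu]
    obtain ⟨b, rfl⟩ := Ideal.Quotient.mk_surjective b
    induction b using MonoidAlgebra.induction_on with
    | of h =>
      have h4 : (σ ^ p) h * y = y * h := hf (by rw [map_mul, h3, hy, map_mul, hy]; group)
      change (s ^ p) (η h) * η y = η y * η h
      rw [h2, ← map_mul, h4, map_mul]
    | add b c hb hc => rw [map_add, map_add, add_mul, mul_add, hb, hc]
    | smul r b hb =>
      have : Ideal.Quotient.mk (Θ.ideal n) (r • b) = r • Ideal.Quotient.mk (Θ.ideal n) b := rfl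
      rw [this, map_smul, smul_mul_assoc, mul_smul_comm, hb]
  have hrel : ∀ (h : H) (k : ℤ), x ^ k = f h → V ^ k = L h := by
    intro h k hk
    obtain ⟨l, rfl⟩ := (hp k).mp ⟨h, hk.symm⟩
    have : h = y ^ l := hf (by rw [← hk, map_zpow, hy, zpow_mul, zpow_natCast])
    rw [this, map_zpow, zpow_mul, zpow_natCast, hVp]
  obtain ⟨ρ, hρ, hρx⟩ := f.exists_extension_of_cyclic L x V σ hσ hLV hgen hrel
  let U := Ξ.unipotent n m m.ne_zero hΞ
  have L_sub : ∀ (k : ℕ+) h, f h ∈ Φ.F k → ∀ j, ∀ b ∈ Ξ.F j, (L h).1 b - b ∈ Ξ.F (j + k) :=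
    fun k h hh j b hb => by
      have := Ξ.mul_mem (hη k h hh) hb
      rwa [sub_mul, one_mul, add_comm] at this
  have ρU : ∀ g, ρ g ∈ U := fun g => by
    obtain ⟨h, k, rfl⟩ := hgen g
    rw [map_mul, map_zpow, hρ, hρx]
    refine mul_mem (L_sub m h (mem_top _)) (zpow_mem ?_ k)
    change ∀ j, ∀ b ∈ Ξ.F j, V.1 b - b ∈ Ξ.F (j + m)
    rw [hV]
    exact X_sub
  -- An element of F_k has to raise the filtration by k. For k ≤ m the shift by m shared by all of G
  -- suffices; for k > m the element comes from H and acts by left multiplication.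
  have key := Φ.lift_apply_mem K (N := Ξ.F) Ξ.antitone (ρ := (Units.coeHom _).comp ρ)
    (fun k g hg j b hb => by
      rcases le_or_gt k m with hkm | hkm
      · exact Ξ.antitone (Nat.add_le_add_left hkm j) (ρU g j b hb)
      · obtain ⟨h, rfl⟩ := hrange (Φ.antitone (PNat.add_one_le_iff.mpr hkm) hg)
        have := L_sub k h hg j b hb
        rwa [← hρ] at this) ha (j := 0) (a := 1) (by rw [Ξ.zero]; trivial)
  rw [zero_add, hΞ, Submodule.mem_bot] at key
  -- Applying the representation to 1 recovers the class of a, so `key` says exactly that this class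
  -- vanishes.
  have e : ∀ a : MonoidAlgebra K H, MonoidAlgebra.lift K _ G ((Units.coeHom _).comp ρ)
      (MonoidAlgebra.mapDomainAlgHom K K f a) 1 = Ideal.Quotient.mk (Θ.ideal n) a := by
    intro a
    induction a using MonoidAlgebra.induction_on with
    | of h =>
      rw [mapDomainAlgHom_of, MonoidAlgebra.lift_of]
      change (ρ (f h)).1 1 = _
      rw [hρ, L_apply, mul_one]
      rfl
    | add b c hb hc => rw [map_add, map_add, LinearMap.add_apply, hb, hc, map_add]
    | smul r b hb => rw [map_smul, map_smul, LinearMap.smul_apply, hb]; rfl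
  exact Ideal.Quotient.eq_zero_iff_mem.mp ((e a).symm.trans key)

end GroupFiltration

end

/-! ### Strictness for the subgroups F_mG, and injectivity in each degree -/

noncomputable section

namespace GroupFiltration

variable (K : Type*) [Field K] {G H : Type*} [Group G] [Group H] (Φ : GroupFiltration G)

theorem mapDomainAlgHom_injective {f : H →* G} (hf : Function.Injective f) :
    Function.Injective (MonoidAlgebra.mapDomainAlgHom K K f) :=
  MonoidAlgebra.mapDomain_injective hf

theorem mapDomainAlgHom_comp {M : Type*} [Group M] (f : H →* G) (g : M →* H)
    (a : MonoidAlgebra K M) :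
    MonoidAlgebra.mapDomainAlgHom K K f (MonoidAlgebra.mapDomainAlgHom K K g a) =
      MonoidAlgebra.mapDomainAlgHom K K (f.comp g) a := by
  induction a using MonoidAlgebra.induction_on with
  | of h => simp only [mapDomainAlgHom_of]; rfl
  | add b c hb hc => simp only [map_add, hb, hc]
  | smul r b hb => simp only [map_smul, hb]

/-- Membership in a term of the filtration of the group algebra involves finitely many elements of
the group. -/
theorem exists_finset_of_mem {n : ℕ} {w : MonoidAlgebra K G} (hw : w ∈ (Φ.groupAlgebra K).F n) :
    ∃ S : Finset G, ∀ {H : Type _} [Group H] (f : H →* G), (S : Set G) ⊆ f.range →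
      ∃ b ∈ ((Φ.comap f).groupAlgebra K).F n, MonoidAlgebra.mapDomainAlgHom K K f b = w := by
  classical
  induction hw using Submodule.span_induction with
  | mem w hw =>
    obtain ⟨l, h1, h2, rfl⟩ := hw
    refine ⟨(l.map Prod.snd).toFinset, fun {H} _ f hS => ?_⟩
    have hl : ∀ p ∈ l, p.2 ∈ f.range := fun p hp =>
      hS (by simpa using ⟨p.1, hp⟩)
    obtain ⟨l', rfl⟩ : ∃ l' : List (ℕ+ × H), l'.map (fun p => (p.1, f p.2)) = l := by
      clear h1 h2 hS
      induction l with
      | nil => exact ⟨[], rfl⟩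
      | cons p l ih =>
        obtain ⟨l', hl'⟩ := ih fun q hq => hl q (by simp [hq])
        obtain ⟨h, hh⟩ := hl p (by simp)
        exact ⟨(p.1, h) :: l', by simp [hl', hh]⟩
    refine ⟨_, Submodule.subset_span ⟨l', fun p hp => ?_, ?_, rfl⟩, ?_⟩
    · exact h1 (p.1, f p.2) (List.mem_map_of_mem (f := fun p => (p.1, f p.2)) hp)
    · rwa [List.map_map] at h2
    · rw [map_list_prod, List.map_map, List.map_map]
      congr 1
      refine List.map_congr_left fun p _ => ?_
      simp only [Function.comp_apply, map_sub, map_one, mapDomainAlgHom_of]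
  | zero => exact ⟨∅, fun f _ => ⟨0, zero_mem _, map_zero _⟩⟩
  | add v w _ _ hv hw =>
    obtain ⟨S, hS⟩ := hv
    obtain ⟨T, hT⟩ := hw
    refine ⟨S ∪ T, fun f hf => ?_⟩
    rw [Finset.coe_union, Set.union_subset_iff] at hf
    obtain ⟨b, hb, rfl⟩ := hS f hf.1
    obtain ⟨c, hc, rfl⟩ := hT f hf.2
    exact ⟨b + c, add_mem hb hc, map_add _ _ _⟩
  | smul r w _ hw =>
    obtain ⟨S, hS⟩ := hw
    refine ⟨S, fun f hf => ?_⟩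
    obtain ⟨b, hb, rfl⟩ := hS f hf
    exact ⟨r • b, Submodule.smul_mem _ _ hb, map_smul _ _ _⟩

open scoped Pointwise in
-- Every subgroup between F_{m+1} and F_m is normalized by F_m, because commutators of elements of
-- F_m lie in F_{m+1}. So P and x generate the product set P⟨x⟩, and the cyclic case applies to the
-- induced filtration.
theorem mem_of_mapDomain_inclusion_zpowers [CharZero K] {m : ℕ+} {P : Subgroup G}
    (h1 : Φ.F (m + 1) ≤ P) (h2 : P ≤ Φ.F m) {x : G} (hx : x ∈ Φ.F m) {n : ℕ}
    {a : MonoidAlgebra K P}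
    (ha : MonoidAlgebra.mapDomainAlgHom K K
        (Subgroup.inclusion (le_sup_left : P ≤ P ⊔ Subgroup.zpowers x)) a ∈
      ((Φ.comap (P ⊔ Subgroup.zpowers x).subtype).groupAlgebra K).F n) :
    a ∈ ((Φ.comap P.subtype).groupAlgebra K).F n := by
  have hle : P ⊔ Subgroup.zpowers x ≤ Φ.F m := sup_le h2 (by rwa [Subgroup.zpowers_le])
  have hconj : ∀ g ∈ Φ.F m, ∀ y ∈ P, g * y * g⁻¹ ∈ P := fun g hg y hy => by
    have h3 : ⁅g, y⁆ ∈ P := h1 <| Φ.antitone (add_le_add_right (one_le (a := m)) m)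
      (Φ.comm_mem hg (h2 hy))
    have : g * y * g⁻¹ = ⁅g, y⁆ * y := by simp [commutatorElement_def]
    rw [this]
    exact mul_mem h3 hy
  have hnorm : Subgroup.zpowers x ≤ Subgroup.normalizer (P : Set G) := by
    rw [Subgroup.zpowers_le, Subgroup.mem_normalizer_iff]
    refine fun y => ⟨hconj x hx y, fun hy => ?_⟩
    have := hconj x⁻¹ (inv_mem hx) _ hy
    simpa [mul_assoc] using this
  have hxP : x ∈ P ⊔ Subgroup.zpowers x :=
    Subgroup.mem_sup_right (Subgroup.mem_zpowers x)
  refine (Φ.comap (P ⊔ Subgroup.zpowers x).subtype).mem_of_mapDomain_mem_of_cyclic K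
    (f := Subgroup.inclusion le_sup_left) (Subgroup.inclusion_injective _) (m := m)
    (eq_top_iff.mpr fun g _ => hle g.2) (fun g hg => ⟨⟨g, h1 hg⟩, rfl⟩) ⟨x, hxP⟩ ?_ ha
  rintro ⟨g, hg⟩
  have hg' : g ∈ (P : Set G) * (Subgroup.zpowers x : Set G) := by
    rwa [← Subgroup.coe_mul_of_right_le_normalizer_left _ _ hnorm]
  obtain ⟨y, hy, _, ⟨k, rfl⟩, rfl⟩ := hg'
  exact ⟨⟨y, hy⟩, k, Subtype.ext (by simp)⟩

/-- Membership in F_n is witnessed by finitely many elements of F_m. Adjoining them one by one to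
F_{m+1} gives a finite tower of cyclic extensions, which is descended one step at a time;
F_m/F_{m+1} need not be finitely generated. -/
theorem mem_of_mapDomain_inclusion [CharZero K] {m : ℕ+} {n : ℕ}
    {a : MonoidAlgebra K (Φ.F (m + 1))} (hm : Φ.F (m + 1) ≤ Φ.F m)
    (ha : MonoidAlgebra.mapDomainAlgHom K K (Subgroup.inclusion hm) a ∈
      ((Φ.comap (Φ.F m).subtype).groupAlgebra K).F n) :
    a ∈ ((Φ.comap (Φ.F (m + 1)).subtype).groupAlgebra K).F n := by
  classical
  have chain : ∀ S : Finset (Φ.F m), ∃ (P : Subgroup G) (h1 : Φ.F (m + 1) ≤ P) (_ : P ≤ Φ.F m),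
      (∀ x ∈ S, (x : G) ∈ P) ∧ ∀ a, MonoidAlgebra.mapDomainAlgHom K K (Subgroup.inclusion h1) a ∈
        ((Φ.comap P.subtype).groupAlgebra K).F n →
          a ∈ ((Φ.comap (Φ.F (m + 1)).subtype).groupAlgebra K).F n := by
    intro S
    induction S using Finset.induction_on with
    | empty =>
      refine ⟨Φ.F (m + 1), le_rfl, hm, by simp, fun a ha => ?_⟩
      have : MonoidAlgebra.mapDomainAlgHom K K (Subgroup.inclusion (le_refl (Φ.F (m + 1)))) a = a := by
        clear ha
        induction a using MonoidAlgebra.induction_on with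
        | of h => rw [mapDomainAlgHom_of]; rfl
        | add b c hb hc => rw [map_add, hb, hc]
        | smul r b hb => rw [map_smul, hb]
      rwa [this] at ha
    | insert x S _ ih =>
      obtain ⟨P, h1, h2, h3, h4⟩ := ih
      refine ⟨P ⊔ Subgroup.zpowers (x : G), h1.trans le_sup_left,
        sup_le h2 (by rw [Subgroup.zpowers_le]; exact x.2), ?_, fun a ha => h4 a ?_⟩
      · intro y hy
        rcases Finset.mem_insert.mp hy with rfl | hy
        · exact Subgroup.mem_sup_right (Subgroup.mem_zpowers _)
        · exact Subgroup.mem_sup_left (h3 y hy)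
      · refine Φ.mem_of_mapDomain_inclusion_zpowers K h1 h2 x.2 ?_
        rw [mapDomainAlgHom_comp]
        exact ha
  obtain ⟨S, hS⟩ := exists_finset_of_mem K _ ha
  obtain ⟨P, h1, h2, h3, h4⟩ := chain S
  obtain ⟨b, hb, hba⟩ := hS (Subgroup.inclusion h2) fun x hx => ⟨⟨x, h3 x hx⟩, rfl⟩
  refine h4 a ?_
  -- K[P] embeds in K[F_m], so the witness b found over P is the image of a.
  have : MonoidAlgebra.mapDomainAlgHom K K (Subgroup.inclusion h1) a = b := by
    refine mapDomainAlgHom_injective K (Subgroup.inclusion_injective h2) ?_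
    rw [hba, mapDomainAlgHom_comp]
    rfl
  rw [this]
  exact hb

/-- In characteristic zero, the filtration of the group algebra of `G` induces that of the group
algebra of `F_m G`. -/
theorem mem_of_mapDomain_subtype [CharZero K] (m : ℕ+) {n : ℕ} {a : MonoidAlgebra K (Φ.F m)}
    (ha : MonoidAlgebra.mapDomainAlgHom K K (Φ.F m).subtype a ∈ (Φ.groupAlgebra K).F n) :
    a ∈ ((Φ.comap (Φ.F m).subtype).groupAlgebra K).F n := by
  induction m using PNat.recOn with
  | one =>
    -- The inclusion of F_1 is onto, so any witness lifts along it.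
    obtain ⟨S, hS⟩ := Φ.exists_finset_of_mem K ha
    obtain ⟨b, hb, hba⟩ := hS (Φ.F 1).subtype fun x _ => by rw [Φ.one, Subgroup.range_subtype]; trivial
    rwa [← mapDomainAlgHom_injective K (Subgroup.subtype_injective _) hba]
  | succ m ih =>
    have hm : Φ.F (m + 1) ≤ Φ.F m := Φ.antitone (PNat.lt_add_right m 1).le
    refine Φ.mem_of_mapDomain_inclusion K hm (ih ?_)
    rw [mapDomainAlgHom_comp]
    exact ha

/-- The map `K[F_i G] → K ⊗ F_i G / F_{i+1} G` with `g ↦ 1 ⊗ {g}`. -/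
def tmulCls (i : ℕ+) : MonoidAlgebra K (Φ.F i) →ₗ[K] K ⊗[ℤ] Φ.Piece i :=
  (Finsupp.linearCombination K fun g : Φ.F i => (1 : K) ⊗ₜ[ℤ] Φ.cls i g g.2).comp
    (MonoidAlgebra.coeffLinearEquiv K).toLinearMap

theorem tmulCls_of (i : ℕ+) (g : Φ.F i) :
    Φ.tmulCls K i (MonoidAlgebra.of K _ g) = 1 ⊗ₜ Φ.cls i g g.2 := by
  simp [tmulCls]

theorem tmulCls_one (i : ℕ+) : Φ.tmulCls K i 1 = 0 := by
  have := Φ.tmulCls_of K i 1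
  rw [map_one] at this
  rw [this]
  exact TensorProduct.tmul_zero _ _

theorem tmulCls_surjective (i : ℕ+) : Function.Surjective (Φ.tmulCls K i) := by
  intro t
  induction t with
  | zero => exact ⟨0, map_zero _⟩
  | tmul c p =>
    obtain ⟨g, hg, rfl⟩ := Φ.cls_surj p
    refine ⟨c • MonoidAlgebra.of K _ ⟨g, hg⟩, ?_⟩
    rw [map_smul, tmulCls_of, TensorProduct.smul_tmul', smul_eq_mul, mul_one]
  | add s t hs ht =>
    obtain ⟨a, rfl⟩ := hs
    obtain ⟨b, rfl⟩ := ht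
    exact ⟨a + b, map_add _ _ _⟩

/-- Since g ↦ {g} is additive, the map kills every product with at least two factors g − 1, whatever
their weights. A single factor of weight at least i + 1 has trivial class, and the empty product has
weight 0. -/
theorem tmulCls_of_mem (i : ℕ+) {a : MonoidAlgebra K (Φ.F i)}
    (ha : a ∈ ((Φ.comap (Φ.F i).subtype).groupAlgebra K).F (i + 1)) : Φ.tmulCls K i a = 0 := by
  have hmul : ∀ (g h : Φ.F i), Φ.tmulCls K i (MonoidAlgebra.of K _ g * MonoidAlgebra.of K _ h) =
      Φ.tmulCls K i (MonoidAlgebra.of K _ g) + Φ.tmulCls K i (MonoidAlgebra.of K _ h) := fun g h => by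
    rw [← map_mul, tmulCls_of, tmulCls_of, tmulCls_of, ← TensorProduct.tmul_add, cls_add]
    rfl
  -- On b = k this is the second difference {ghk} − {gk} − {hk} + {k} of an additive map.
  have hmul3 : ∀ (g h : Φ.F i) (b : MonoidAlgebra K (Φ.F i)), Φ.tmulCls K i
      ((MonoidAlgebra.of K _ g - 1) * ((MonoidAlgebra.of K _ h - 1) * b)) = 0 := fun g h b => by
    induction b using MonoidAlgebra.induction_on with
    | of k =>
      simp only [sub_mul, mul_sub, one_mul, map_sub, ← map_mul (MonoidAlgebra.of K (Φ.F i))]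
      simp only [map_mul (MonoidAlgebra.of K (Φ.F i)), hmul]
      rw [← map_mul (MonoidAlgebra.of K (Φ.F i)) h k, hmul, map_mul, hmul]
      abel
    | add b c hb hc => rw [mul_add, mul_add, map_add, hb, hc, add_zero]
    | smul r b hb => rw [mul_smul_comm, mul_smul_comm, map_smul, hb, smul_zero]
  refine (Submodule.span_le.mpr ?_ : ((Φ.comap (Φ.F i).subtype).groupAlgebra K).F (i + 1) ≤
    LinearMap.ker (Φ.tmulCls K i)) ha
  rintro _ ⟨l, h1, h2, rfl⟩
  change Φ.tmulCls K i _ = 0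
  match l with
  | [] => simp at h2
  | [p] =>
    have h3 : (p.2 : G) ∈ Φ.F (i + 1) :=
      Φ.antitone (show i + 1 ≤ p.1 by simpa [← PNat.coe_le_coe] using h2) (h1 p (by simp))
    rw [List.map_singleton, List.prod_singleton, map_sub, tmulCls_one, sub_zero, tmulCls_of]
    have : Φ.cls i (p.2 : G) p.2.2 = 0 := by
      rw [← cls_one]
      exact Φ.cls_eq (by simpa using h3)
    rw [this, TensorProduct.tmul_zero]
  | p :: q :: l =>
    rw [List.map_cons, List.map_cons, List.prod_cons, List.prod_cons]
    exact hmul3 _ _ _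

/-- In characteristic zero, the degree `i` part of `K ⊗ Gr G` embeds in the associated graded of the
group algebra. -/
theorem tmulCls_eq_zero [CharZero K] (i : ℕ+) {a : MonoidAlgebra K (Φ.F i)}
    (ha : MonoidAlgebra.mapDomainAlgHom K K (Φ.F i).subtype a -
        algebraMap K _ (Bialgebra.counitAlgHom K (MonoidAlgebra K (Φ.F i)) a) ∈
      (Φ.groupAlgebra K).F (i + 1)) : Φ.tmulCls K i a = 0 := by
  rw [← AlgHom.commutes (MonoidAlgebra.mapDomainAlgHom K K (Φ.F i).subtype), ← map_sub] at ha
  have := Φ.tmulCls_of_mem K i (Φ.mem_of_mapDomain_subtype K i ha)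
  rwa [map_sub, Algebra.algebraMap_eq_smul_one, map_smul, tmulCls_one, smul_zero, sub_zero] at this

end GroupFiltration

end

/-! ### The Dynkin operator and primitive elements -/

noncomputable section

namespace AlgFiltration

variable {K A : Type*} [Field K] [Ring A] [Algebra K A] (Θ : AlgFiltration K A)

/-- The filtration of `A ⊗ A` is induced by that of the tensor square of the completion. -/
theorem mem_tensor_of_map_toCompletion {n : ℕ} {w : A ⊗[K] A}
    (hw : Algebra.TensorProduct.map Θ.toCompletion Θ.toCompletion w ∈
      (Θ.completed.tensor Θ.completed).F n) : w ∈ (Θ.tensor Θ).F n := by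
  -- A linear section of A → A/F_n gives a linear map r from the completion to A that respects F_j
  -- for j ≤ n and is the identity on A modulo F_n; r ⊗ r then carries membership in F_n back to A ⊗
  -- A.
  obtain ⟨s, hs⟩ := (Ideal.Quotient.mkₐ K (Θ.ideal n)).toLinearMap.exists_rightInverse_of_surjective
    (LinearMap.range_eq_top.mpr (Ideal.Quotient.mkₐ_surjective K _))
  let r : Θ.Completion →ₗ[K] A := s.comp (Θ.proj n).toLinearMap
  have mk_r : ∀ x, Ideal.Quotient.mk (Θ.ideal n) (r x) = Θ.proj n x :=
    fun x => LinearMap.congr_fun hs (Θ.proj n x)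
  have r_mem : ∀ j ≤ n, ∀ x ∈ Θ.completed.F j, r x ∈ Θ.F j := fun j hj x hx => by
    have h1 := Θ.factor_proj hj x
    rw [← mk_r, show Θ.proj j x = 0 from hx] at h1
    exact Ideal.Quotient.eq_zero_iff_mem.mp h1
  have r_sub : ∀ a, r (Θ.toCompletion a) - a ∈ Θ.F n := fun a =>
    Ideal.Quotient.eq.mp (mk_r (Θ.toCompletion a))
  have top : ∀ a, a ∈ Θ.F 0 := fun a => by rw [Θ.zero]; trivial
  have h1 : ∀ v ∈ (Θ.completed.tensor Θ.completed).F n,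
      TensorProduct.map r r v ∈ (Θ.tensor Θ).F n := by
    intro v hv
    refine (iSup_le fun ⟨p, hp⟩ => ?_ : (Θ.completed.tensor Θ.completed).F n ≤
      ((Θ.tensor Θ).F n).comap (TensorProduct.map r r)) hv
    refine Submodule.map₂_le.mpr fun x hx y hy => ?_
    rw [Submodule.mem_comap, TensorProduct.mk_apply, TensorProduct.map_tmul]
    have := Θ.tmul_mem Θ (r_mem p.1 (by omega) x hx) (r_mem p.2 (by omega) y hy)
    rwa [hp] at this
  have h2 : ∀ v : A ⊗[K] A, TensorProduct.map r r
      (Algebra.TensorProduct.map Θ.toCompletion Θ.toCompletion v) - v ∈ (Θ.tensor Θ).F n := by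
    intro v
    induction v with
    | zero => simp
    | add v w hv hw =>
      rw [map_add, map_add, add_sub_add_comm]
      exact add_mem hv hw
    | tmul a b =>
      rw [Algebra.TensorProduct.map_tmul, TensorProduct.map_tmul]
      have e : r (Θ.toCompletion a) ⊗ₜ[K] r (Θ.toCompletion b) - a ⊗ₜ[K] b =
          (r (Θ.toCompletion a) - a) ⊗ₜ r (Θ.toCompletion b) +
            a ⊗ₜ (r (Θ.toCompletion b) - b) := by
        rw [TensorProduct.sub_tmul, TensorProduct.tmul_sub]; abel
      rw [e]
      have h3 := Θ.tmul_mem Θ (r_sub a) (top (r (Θ.toCompletion b)))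
      have h4 := Θ.tmul_mem Θ (top a) (r_sub b)
      rw [zero_add] at h4
      exact add_mem h3 h4
  have := sub_mem (h1 _ hw) (h2 w)
  rwa [sub_sub_cancel] at this

/-- A linear map that acts as multiplication by `j` on the `j`-th piece of the associated graded
for `j ≤ N`. -/
theorem exists_degree_map (N : ℕ) : ∃ E : A →ₗ[K] A,
    (∀ j ≤ N, ∀ a ∈ Θ.F j, E a - (j : K) • a ∈ Θ.F (j + 1)) := by
  -- For the induction, E is required to be exactly N on F_N; adding a linear projection onto
  -- F_{N+1} passes from N to N + 1 and disturbs lower degrees only by terms in F_{N+1}.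
  suffices h : ∃ E : A →ₗ[K] A, (∀ j < N, ∀ a ∈ Θ.F j, E a - (j : K) • a ∈ Θ.F (j + 1)) ∧
      ∀ a ∈ Θ.F N, E a = (N : K) • a by
    obtain ⟨E, h1, h2⟩ := h
    refine ⟨E, fun j hj a ha => ?_⟩
    rcases hj.lt_or_eq with hj | rfl
    · exact h1 j hj a ha
    · rw [h2 a ha, sub_self]; exact zero_mem _
  induction N with
  | zero => exact ⟨0, by simp, by simp⟩
  | succ N ih =>
    obtain ⟨E, h1, h2⟩ := ih
    obtain ⟨π, hπ⟩ := (Θ.F (N + 1)).subtype.exists_leftInverse_of_injective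
      (Submodule.ker_subtype _)
    have hπ' : ∀ a (ha : a ∈ Θ.F (N + 1)), (π a : A) = a := fun a ha =>
      congrArg Subtype.val (LinearMap.congr_fun hπ ⟨a, ha⟩)
    refine ⟨E + (Θ.F (N + 1)).subtype.comp π, fun j hj a ha => ?_, fun a ha => ?_⟩
    · have h3 : (π a : A) ∈ Θ.F (j + 1) := Θ.antitone (by omega) (π a).2
      change E a + π a - _ ∈ _
      rw [add_sub_right_comm]
      refine add_mem ?_ h3
      rcases (Nat.lt_succ_iff.mp hj).lt_or_eq with hj | rfl
      · exact h1 j hj a ha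
      · rw [h2 a ha, sub_self]; exact zero_mem _
    · change E a + π a = _
      rw [h2 a (Θ.antitone N.le_succ ha), hπ' a ha, Nat.cast_succ, add_smul, one_smul]

end AlgFiltration

namespace GroupFiltration

variable (K : Type*) [Field K] {G : Type*} [Group G] (Φ : GroupFiltration G)

theorem comul_of (g : G) : Bialgebra.comulAlgHom K _ (MonoidAlgebra.of K G g) =
    MonoidAlgebra.of K G g ⊗ₜ[K] MonoidAlgebra.of K G g := by
  simp

/-- The bound is known in the tensor square of the completion; strictness brings it down to K[G] ⊗
K[G]. -/
theorem comul_mem {n : ℕ} {a : MonoidAlgebra K G} (ha : a ∈ (Φ.groupAlgebra K).F n) :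
    Bialgebra.comulAlgHom K _ a ∈ ((Φ.groupAlgebra K).tensor (Φ.groupAlgebra K)).F n :=
  AlgFiltration.mem_tensor_of_map_toCompletion _ (Φ.preComul_mem K n a ha)

theorem antipode_of (g : G) : HopfAlgebra.antipode K (MonoidAlgebra.of K G g) =
    MonoidAlgebra.of K G g⁻¹ := by
  simp

theorem antipode_mul_of (a : MonoidAlgebra K G) (g : G) :
    HopfAlgebra.antipode K (a * MonoidAlgebra.of K G g) =
      MonoidAlgebra.of K G g⁻¹ * HopfAlgebra.antipode K a := by
  induction a using MonoidAlgebra.induction_on with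
  | of h => rw [← map_mul, antipode_of, antipode_of, mul_inv_rev, map_mul]
  | add b c hb hc => rw [add_mul, map_add, map_add, hb, hc, mul_add]
  | smul r b hb => rw [smul_mul_assoc, map_smul, map_smul, hb, mul_smul_comm]

/-- The antipode reverses products and sends g − 1 to g⁻¹ − 1, which has the same weight; hence the
induction from the right end of the list. -/
theorem antipode_mem {n : ℕ} {a : MonoidAlgebra K G} (ha : a ∈ (Φ.groupAlgebra K).F n) :
    HopfAlgebra.antipode K a ∈ (Φ.groupAlgebra K).F n := by
  refine (Submodule.span_le.mpr ?_ : (Φ.groupAlgebra K).F n ≤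
    ((Φ.groupAlgebra K).F n).comap (HopfAlgebra.antipode K)) ha
  rintro _ ⟨l, h1, h2, rfl⟩
  refine (Φ.groupAlgebra K).antitone h2 ?_
  clear h2
  induction l using List.reverseRecOn with
  | nil => rw [List.map_nil, List.sum_nil, AlgFiltration.zero]; trivial
  | append_singleton l p ih =>
    have h3 := ih fun q hq => h1 q (by simp [hq])
    have h4 : MonoidAlgebra.of K G p.2⁻¹ - 1 ∈ (Φ.groupAlgebra K).F p.1 :=
      Submodule.subset_span (Φ.of_sub_one_mem K (inv_mem (h1 p (by simp))))
    rw [List.map_append, List.map_append, List.prod_append, List.sum_append, List.map_singleton,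
      List.map_singleton, List.prod_singleton, List.sum_singleton, mul_sub, mul_one, map_sub,
      antipode_mul_of, ← sub_one_mul, add_comm]
    exact (Φ.groupAlgebra K).mul_mem h4 h3

/-- The elements of the group algebra that modulo `F_{w+1}` are combinations of the `g - 1` with
`g ∈ F_w G`. -/
def lieSpan (w : ℕ) : Submodule K (MonoidAlgebra K G) :=
  Submodule.span K {a | ∃ k : ℕ+, (k : ℕ) = w ∧ ∃ g ∈ Φ.F k, a = MonoidAlgebra.of K G g - 1} ⊔
    (Φ.groupAlgebra K).F (w + 1)

theorem of_sub_one_mem_lieSpan {k : ℕ+} {g : G} (hg : g ∈ Φ.F k) :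
    MonoidAlgebra.of K G g - 1 ∈ Φ.lieSpan K k :=
  Submodule.mem_sup_left (Submodule.subset_span ⟨k, rfl, g, hg, rfl⟩)

/-- Both sides are cm − m. Used with c the class of a group commutator, whose factor c − 1 makes the
last term one degree deeper. -/
theorem commutator_sub_one_identity {A : Type*} [Ring A] {x y c m : A} (h1 : c * m = x * y)
    (h2 : m = y * x) :
    (x - 1) * (y - 1) - (y - 1) * (x - 1) = (c - 1) + (c - 1) * (m - 1) := by
  have e : (c - 1) + (c - 1) * (m - 1) = c * m - m := by noncomm_ring
  rw [e, h1, h2]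
  noncomm_ring

/-- On generators, [h − 1, g − 1] has leading term [h,g] − 1, an element of the same kind in degree
j + k. -/
theorem commutator_mem_lieSpan {w : ℕ} {y : MonoidAlgebra K G} (hy : y ∈ Φ.lieSpan K w) {k : ℕ+}
    {g : G} (hg : g ∈ Φ.F k) :
    y * (MonoidAlgebra.of K G g - 1) - (MonoidAlgebra.of K G g - 1) * y ∈ Φ.lieSpan K (w + k) := by
  set Θ := Φ.groupAlgebra K
  set z := MonoidAlgebra.of K G g - 1 with hz
  have hzm : z ∈ Θ.F k := Submodule.subset_span (Φ.of_sub_one_mem K hg)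
  refine (sup_le (Submodule.span_le.mpr ?_) ?_ : Φ.lieSpan K w ≤ (Φ.lieSpan K (w + k)).comap
    (LinearMap.mulRight K z - LinearMap.mulLeft K z)) hy
  · rintro _ ⟨j, rfl, h, hh, rfl⟩
    change (MonoidAlgebra.of K G h - 1) * z - z * (MonoidAlgebra.of K G h - 1) ∈
      Φ.lieSpan K (j + k)
    have hc := Φ.comm_mem hh hg
    have e : (MonoidAlgebra.of K G h - 1) * z - z * (MonoidAlgebra.of K G h - 1) =
        (MonoidAlgebra.of K G ⁅h, g⁆ - 1) +
          (MonoidAlgebra.of K G ⁅h, g⁆ - 1) * (MonoidAlgebra.of K G (g * h) - 1) := by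
      have h1 : MonoidAlgebra.of K G ⁅h, g⁆ * MonoidAlgebra.of K G (g * h) =
          MonoidAlgebra.of K G h * MonoidAlgebra.of K G g := by
        rw [← map_mul, ← map_mul]
        congr 1
        simp [commutatorElement_def, mul_assoc]
      exact commutator_sub_one_identity h1 (map_mul _ _ _)
    rw [e]
    have h1 := Φ.of_sub_one_mem_lieSpan K hc
    have h2 : MonoidAlgebra.of K G ⁅h, g⁆ - 1 ∈ Θ.F (j + k : ℕ+) :=
      Submodule.subset_span (Φ.of_sub_one_mem K hc)
    have h3 : MonoidAlgebra.of K G (g * h) - 1 ∈ Θ.F (1 : ℕ+) :=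
      Submodule.subset_span (Φ.of_sub_one_mem K (k := 1) (by rw [Φ.one]; trivial))
    rw [PNat.add_coe] at h1 h2
    exact add_mem h1 (Submodule.mem_sup_right (Θ.mul_mem h2 h3))
  · intro y hy
    refine Submodule.mem_sup_right ?_
    have h1 := Θ.mul_mem hy hzm
    have h2 := Θ.mul_mem hzm hy
    rw [add_comm] at h2
    have := sub_mem h1 h2
    rwa [add_right_comm] at this

section Dynkin

variable (E : MonoidAlgebra K G →ₗ[K] MonoidAlgebra K G)

/-- The map `u ⊗ v ↦ S(u) E(v)`. -/
def convolve : MonoidAlgebra K G ⊗[K] MonoidAlgebra K G →ₗ[K] MonoidAlgebra K G :=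
  TensorProduct.lift ((LinearMap.mul K (MonoidAlgebra K G)).compl₁₂ (HopfAlgebra.antipode K) E)

theorem convolve_tmul (u v : MonoidAlgebra K G) :
    convolve K E (u ⊗ₜ v) = HopfAlgebra.antipode K u * E v := by
  simp [convolve]

/-- The antipode axiom: on a group element it reads g⁻¹g = 1. -/
theorem convolve_id_comul (a : MonoidAlgebra K G) :
    convolve K LinearMap.id (Bialgebra.comulAlgHom K _ a) =
      algebraMap K _ (Bialgebra.counitAlgHom K _ a) := by
  induction a using MonoidAlgebra.induction_on with
  | of g =>
    rw [comul_of, convolve_tmul, antipode_of, LinearMap.id_apply, ← map_mul, inv_mul_cancel]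
    simp
  | add b c hb hc => simp only [map_add, hb, hc]
  | smul r b hb => rw [map_smul, map_smul, hb, map_smul, Algebra.smul_def, smul_eq_mul, map_mul]

variable {N : ℕ} {E}

theorem degree_map_mem (hE : ∀ j ≤ N, ∀ a ∈ (Φ.groupAlgebra K).F j,
      E a - (j : K) • a ∈ (Φ.groupAlgebra K).F (j + 1))
    {j : ℕ} (hj : j ≤ N) {a : MonoidAlgebra K G} (ha : a ∈ (Φ.groupAlgebra K).F j) :
    E a ∈ (Φ.groupAlgebra K).F j := by
  have := add_mem ((Φ.groupAlgebra K).antitone j.le_succ (hE j hj a ha))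
    (Submodule.smul_mem _ (j : K) ha)
  rwa [sub_add_cancel] at this

theorem convolve_mem (hE : ∀ j ≤ N, ∀ a ∈ (Φ.groupAlgebra K).F j,
      E a - (j : K) • a ∈ (Φ.groupAlgebra K).F (j + 1))
    {j : ℕ} (hj : j ≤ N) {w : MonoidAlgebra K G ⊗[K] MonoidAlgebra K G}
    (hw : w ∈ ((Φ.groupAlgebra K).tensor (Φ.groupAlgebra K)).F j) :
    convolve K E w ∈ (Φ.groupAlgebra K).F j := by
  refine (iSup_le fun ⟨p, hp⟩ => ?_ : ((Φ.groupAlgebra K).tensor (Φ.groupAlgebra K)).F j ≤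
      ((Φ.groupAlgebra K).F j).comap (convolve K E)) hw
  refine Submodule.map₂_le.mpr fun u hu v hv => ?_
  rw [Submodule.mem_comap, TensorProduct.mk_apply, convolve_tmul]
  have := (Φ.groupAlgebra K).mul_mem (Φ.antipode_mem K hu)
    (Φ.degree_map_mem K hE (j := p.2) (by omega) hv)
  rwa [hp] at this

/-- To be read with γ = g⁻¹, z = g − 1, P = S(u), e = E(v). Every term on the right is of higher
degree than its leading part, either by the factor γ − 1 or by the error ε. -/
theorem convolve_identity {A : Type*} [Ring A] [Algebra K A] (c : K) (γ z P e v ε : A)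
    (h : γ * z = 1 - γ) :
    γ * P * (e + (ε + e * z + c • (v * z))) - P * e - (P * e * z - z * (P * e)) -
      c • (P * v * z) = (γ - 1) * (P * e * z - z * (P * e)) +
        c • ((γ - 1) * (P * (v * z))) + γ * (P * ε) := by
  have e2 : γ * (z * (P * e)) = P * e - γ * (P * e) := by
    rw [← mul_assoc, h, sub_mul, one_mul]
  simp only [mul_add, mul_sub, sub_mul, one_mul, mul_smul_comm, smul_sub, e2, mul_assoc]
  abel

/-- Two facts combine: S(ug) = g⁻¹S(u), which turns right multiplication into a commutator with g −
1, and E(vz) ≡ E(v)z + k vz, because E is a derivation up to higher degree. -/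
theorem convolve_tmul_mul_sub_mem (hE : ∀ j ≤ N, ∀ a ∈ (Φ.groupAlgebra K).F j,
      E a - (j : K) • a ∈ (Φ.groupAlgebra K).F (j + 1))
    {i j : ℕ} {k : ℕ+} (hj : i + j + k ≤ N) {u v : MonoidAlgebra K G}
    (hu : u ∈ (Φ.groupAlgebra K).F i) (hv : v ∈ (Φ.groupAlgebra K).F j) {g : G} (hg : g ∈ Φ.F k) :
    convolve K E (u ⊗ₜ v * (MonoidAlgebra.of K G g ⊗ₜ MonoidAlgebra.of K G g)) -
      convolve K E (u ⊗ₜ v) - (convolve K E (u ⊗ₜ v) * (MonoidAlgebra.of K G g - 1) -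
        (MonoidAlgebra.of K G g - 1) * convolve K E (u ⊗ₜ v)) -
      (k : K) • (convolve K LinearMap.id (u ⊗ₜ v) * (MonoidAlgebra.of K G g - 1)) ∈
        (Φ.groupAlgebra K).F (i + j + k + 1) := by
  rw [Algebra.TensorProduct.tmul_mul_tmul, convolve_tmul, convolve_tmul, convolve_tmul,
    LinearMap.id_apply, antipode_mul_of]
  have hP := Φ.antipode_mem K hu
  have he := Φ.degree_map_mem K hE (j := j) (by omega) hv
  generalize HopfAlgebra.antipode K u = P at hP ⊢
  have hzm : MonoidAlgebra.of K G g - 1 ∈ (Φ.groupAlgebra K).F k :=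
    Submodule.subset_span (Φ.of_sub_one_mem K hg)
  have hγm : MonoidAlgebra.of K G g⁻¹ - 1 ∈ (Φ.groupAlgebra K).F (1 : ℕ+) :=
    Submodule.subset_span (Φ.of_sub_one_mem K (k := 1) (by rw [Φ.one]; trivial))
  have hγz : MonoidAlgebra.of K G g⁻¹ * (MonoidAlgebra.of K G g - 1) =
      1 - MonoidAlgebra.of K G g⁻¹ := by
    rw [mul_sub, mul_one, ← map_mul, inv_mul_cancel, map_one]
  have hvg : v * MonoidAlgebra.of K G g = v + v * (MonoidAlgebra.of K G g - 1) := by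
    rw [mul_sub, mul_one, add_sub_cancel]
  have hmem : MonoidAlgebra.of K G g⁻¹ ∈ (Φ.groupAlgebra K).F 0 := by
    rw [AlgFiltration.zero]; trivial
  rw [hvg, map_add]
  rw [PNat.one_coe] at hγm
  generalize MonoidAlgebra.of K G g⁻¹ = γ at *
  generalize MonoidAlgebra.of K G g - 1 = z at *
  have h1 := hE j (by omega) v hv
  have h2 := hE (j + k) (by omega) (v * z) ((Φ.groupAlgebra K).mul_mem hv hzm)
  generalize Φ.groupAlgebra K = Θ at *
  -- The degrees j + k and j prescribed for vz and v differ by k; ε collects the two errors of E.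
  obtain ⟨ε, hε, hEv⟩ : ∃ ε ∈ Θ.F (j + k + 1),
      E (v * z) = ε + E v * z + ((k : ℕ) : K) • (v * z) := by
    refine ⟨E (v * z) - ((j + k : ℕ) : K) • (v * z) - (E v - (j : K) • v) * z, ?_, ?_⟩
    · have := Θ.mul_mem h1 hzm
      rw [add_right_comm] at this
      exact sub_mem h2 this
    · rw [sub_mul, smul_mul_assoc, Nat.cast_add, add_smul]
      abel
  rw [hEv]
  generalize E v = e at *
  have hx : P * e ∈ Θ.F (i + j) := Θ.mul_mem hP he
  have hPv : P * (v * z) ∈ Θ.F (i + j + k) := by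
    have := Θ.mul_mem hP (Θ.mul_mem hv hzm)
    rwa [← add_assoc] at this
  have h3 : (γ - 1) * (P * e * z - z * (P * e)) ∈ Θ.F (i + j + k + 1) := by
    have h4 := Θ.mul_mem hzm hx
    rw [add_comm] at h4
    have := Θ.mul_mem hγm (sub_mem (Θ.mul_mem hx hzm) h4)
    rwa [add_comm] at this
  have h5 : ((k : ℕ) : K) • ((γ - 1) * (P * (v * z))) ∈ Θ.F (i + j + k + 1) := by
    have := Θ.mul_mem hγm hPv
    rw [add_comm] at this
    exact Submodule.smul_mem _ _ this
  have h6 : γ * (P * ε) ∈ Θ.F (i + j + k + 1) := by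
    have h7 := Θ.mul_mem hmem (Θ.mul_mem hP hε)
    rwa [zero_add, ← add_assoc, ← add_assoc] at h7
  rw [convolve_identity K _ _ _ _ _ _ _ hγz]
  exact add_mem (add_mem h3 h5) h6

theorem convolve_mul_sub_mem (hE : ∀ j ≤ N, ∀ a ∈ (Φ.groupAlgebra K).F j,
      E a - (j : K) • a ∈ (Φ.groupAlgebra K).F (j + 1))
    {j : ℕ} {k : ℕ+} (hj : j + k ≤ N) {w : MonoidAlgebra K G ⊗[K] MonoidAlgebra K G}
    (hw : w ∈ ((Φ.groupAlgebra K).tensor (Φ.groupAlgebra K)).F j) {g : G} (hg : g ∈ Φ.F k) :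
    convolve K E (w * (MonoidAlgebra.of K G g ⊗ₜ MonoidAlgebra.of K G g)) - convolve K E w -
      (convolve K E w * (MonoidAlgebra.of K G g - 1) -
        (MonoidAlgebra.of K G g - 1) * convolve K E w) -
      (k : K) • (convolve K LinearMap.id w * (MonoidAlgebra.of K G g - 1)) ∈
        (Φ.groupAlgebra K).F (j + k + 1) := by
  let Λ : MonoidAlgebra K G ⊗[K] MonoidAlgebra K G →ₗ[K] MonoidAlgebra K G :=
    (convolve K E).comp (LinearMap.mulRight K (MonoidAlgebra.of K G g ⊗ₜ MonoidAlgebra.of K G g)) -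
      convolve K E - ((LinearMap.mulRight K (MonoidAlgebra.of K G g - 1)).comp (convolve K E) -
        (LinearMap.mulLeft K (MonoidAlgebra.of K G g - 1)).comp (convolve K E)) -
      (k : K) • (LinearMap.mulRight K (MonoidAlgebra.of K G g - 1)).comp (convolve K LinearMap.id)
  have hΛ : ∀ w, Λ w = convolve K E (w * (MonoidAlgebra.of K G g ⊗ₜ MonoidAlgebra.of K G g)) -
      convolve K E w - (convolve K E w * (MonoidAlgebra.of K G g - 1) -
        (MonoidAlgebra.of K G g - 1) * convolve K E w) -
      (k : K) • (convolve K LinearMap.id w * (MonoidAlgebra.of K G g - 1)) := fun _ => rfl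
  rw [← hΛ]
  refine (iSup_le fun ⟨p, hp⟩ => ?_ : ((Φ.groupAlgebra K).tensor (Φ.groupAlgebra K)).F j ≤
    ((Φ.groupAlgebra K).F (j + k + 1)).comap Λ) hw
  refine Submodule.map₂_le.mpr fun u hu v hv => ?_
  rw [Submodule.mem_comap, TensorProduct.mk_apply, hΛ, ← hp]
  exact Φ.convolve_tmul_mul_sub_mem K hE (by dsimp only; omega) hu hv hg

/-- Writing Ψ for the convolution after the coproduct, multiplying by a last factor z = g − 1 of
weight k gives Ψ(bz) ≡ [Ψ(b), z] + k ε(b)z. Thus Ψ of a product is built from nested brackets. -/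
theorem dynkin_mem_lieSpan (hE : ∀ j ≤ N, ∀ a ∈ (Φ.groupAlgebra K).F j,
      E a - (j : K) • a ∈ (Φ.groupAlgebra K).F (j + 1))
    (l : List (ℕ+ × G)) (hl : ∀ p ∈ l, p.2 ∈ Φ.F p.1) (hN : (l.map fun p => (p.1 : ℕ)).sum ≤ N) :
    convolve K E (Bialgebra.comulAlgHom K _ (l.map fun p => MonoidAlgebra.of K G p.2 - 1).prod) ∈
      Φ.lieSpan K (l.map fun p => (p.1 : ℕ)).sum := by
  induction l using List.reverseRecOn with
  | nil =>
    -- In weight 0 there are no generators, as weights are positive, so `lieSpan` is just F_1, and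
    -- it contains E(1).
    have := hE 0 (Nat.zero_le _) 1 (by rw [AlgFiltration.zero]; trivial)
    rw [Nat.cast_zero, zero_smul, sub_zero] at this
    rw [List.map_nil, List.map_nil, List.prod_nil, List.sum_nil, map_one,
      Algebra.TensorProduct.one_def, convolve_tmul, HopfAlgebra.antipode_one, one_mul]
    exact Submodule.mem_sup_right this
  | append_singleton l p ih =>
    rw [List.map_append, List.map_append, List.prod_append, List.sum_append, List.map_singleton,
      List.map_singleton, List.prod_singleton, List.sum_singleton]
    rw [List.map_append, List.sum_append, List.map_singleton, List.sum_singleton] at hN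
    have hp := hl p (by simp)
    have h1 := ih (fun q hq => hl q (by simp [hq])) (by omega)
    have hb : (l.map fun p => MonoidAlgebra.of K G p.2 - 1).prod ∈
        (Φ.groupAlgebra K).F (l.map fun p => (p.1 : ℕ)).sum :=
      Submodule.subset_span ⟨l, fun q hq => hl q (by simp [hq]), le_rfl, rfl⟩
    -- The term k ε(b)z has the right weight only if b has weight 0; otherwise ε(b) = 0.
    have hb0 : (l.map fun p => (p.1 : ℕ)).sum = 0 ∨ Bialgebra.counitAlgHom K (MonoidAlgebra K G)
        (l.map fun p => MonoidAlgebra.of K G p.2 - 1).prod = 0 := by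
      rcases Nat.eq_zero_or_pos (l.map fun p => (p.1 : ℕ)).sum with h | h
      · exact Or.inl h
      · exact Or.inr (Φ.counit_of_mem K ((Φ.groupAlgebra K).antitone h hb))
    set b := (l.map fun p => MonoidAlgebra.of K G p.2 - 1).prod
    set w := (l.map fun p => (p.1 : ℕ)).sum
    have h2 := Φ.convolve_mul_sub_mem K hE hN (Φ.comul_mem K hb) hp
    have h3 := Φ.commutator_mem_lieSpan K h1 hp
    have h4 : ((p.1 : ℕ) : K) • (convolve K LinearMap.id (Bialgebra.comulAlgHom K _ b) *
        (MonoidAlgebra.of K G p.2 - 1)) ∈ Φ.lieSpan K (w + p.1) := by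
      refine Submodule.smul_mem _ _ ?_
      rw [convolve_id_comul, ← Algebra.smul_def]
      rcases hb0 with h0 | h0
      · rw [h0, zero_add]
        exact Submodule.smul_mem _ _ (Φ.of_sub_one_mem_lieSpan K hp)
      · rw [h0, zero_smul]; exact zero_mem _
    have h5 := add_mem (add_mem (Submodule.mem_sup_right h2 : _ ∈ Φ.lieSpan K (w + p.1)) h4) h3
    rw [sub_add_cancel, sub_add_cancel] at h5
    rwa [mul_sub, mul_one, map_sub, map_mul, comul_of, map_sub]

end Dynkin

/-- Elements of `F_i` that are primitive modulo `F_{i+1}` are combinations of the `g - 1` with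
`g ∈ F_i G` modulo `F_{i+1}`. -/
theorem mem_lieSpan_of_primitive [CharZero K] {i : ℕ} (hi : i ≠ 0) {a : MonoidAlgebra K G}
    (ha : a ∈ (Φ.groupAlgebra K).F i)
    (hprim : Bialgebra.comulAlgHom K _ a - (a ⊗ₜ[K] 1 + 1 ⊗ₜ[K] a) ∈
      ((Φ.groupAlgebra K).tensor (Φ.groupAlgebra K)).F (i + 1)) : a ∈ Φ.lieSpan K i := by
  -- The range must include i + 1, where the failure of primitivity lives.
  obtain ⟨E, hE⟩ := (Φ.groupAlgebra K).exists_degree_map (i + 1)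
  set Θ := Φ.groupAlgebra K
  have h1 : convolve K E (Bialgebra.comulAlgHom K _ a) ∈ Φ.lieSpan K i := by
    refine (Submodule.span_le.mpr ?_ : Θ.F i ≤ (Φ.lieSpan K i).comap
      ((convolve K E).comp (Bialgebra.comulAlgHom K _).toLinearMap)) ha
    rintro _ ⟨l, h1, h2, rfl⟩
    change convolve K E (Bialgebra.comulAlgHom K _ _) ∈ Φ.lieSpan K i
    rcases h2.eq_or_lt with h2 | h2
    · rw [h2]
      exact Φ.dynkin_mem_lieSpan K hE l h1 (by omega)
    · refine Submodule.mem_sup_right (Φ.convolve_mem K hE le_rfl (Φ.comul_mem K ?_))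
      exact Submodule.subset_span ⟨l, h1, h2, rfl⟩
  have h2 : convolve K E (Bialgebra.comulAlgHom K _ a - (a ⊗ₜ[K] 1 + 1 ⊗ₜ[K] a)) ∈
      Φ.lieSpan K i := Submodule.mem_sup_right (Φ.convolve_mem K hE le_rfl hprim)
  have h3 : HopfAlgebra.antipode K a * E 1 ∈ Φ.lieSpan K i := by
    have := hE 0 (Nat.zero_le _) 1 (by rw [AlgFiltration.zero]; trivial)
    rw [Nat.cast_zero, zero_smul, sub_zero] at this
    exact Submodule.mem_sup_right (Θ.mul_mem (Φ.antipode_mem K ha) this)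
  have h4 : E a - (i : K) • a ∈ Φ.lieSpan K i := Submodule.mem_sup_right (hE i i.le_succ a ha)
  rw [map_sub, map_add, convolve_tmul, convolve_tmul, HopfAlgebra.antipode_one, one_mul] at h2
  have h5 := sub_mem (sub_mem (sub_mem h1 h2) h3) h4
  -- Primitivity gives Ψ(a) ≡ S(a)E(1) + E(a); here S(a)E(1) lies in F_{i+1} and E(a) ≡ ia.
  have e : convolve K E (Bialgebra.comulAlgHom K _ a) -
      (convolve K E (Bialgebra.comulAlgHom K _ a) - (HopfAlgebra.antipode K a * E 1 + E a)) -
      HopfAlgebra.antipode K a * E 1 - (E a - (i : K) • a) = (i : K) • a := by abel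
  rw [e] at h5
  exact (Submodule.smul_mem_iff _ (Nat.cast_ne_zero.mpr hi)).mp h5

end GroupFiltration

end

/-! ### Logarithms of unipotent elements, and primitivity of log ι(g) -/

noncomputable section

namespace Polynomial

variable {K : Type*} [Field K]

/-- After applying a linear functional, the hypothesis is an equality of polynomials at all natural
numbers, hence a formal one, and may be differentiated at 0. Functionals separate points over a
field. -/
theorem sum_derivative_eval_zero_smul [CharZero K] {M : Type*} [AddCommGroup M] [Module K M] {ι κ : Type*}
    (s : Finset ι) (t : Finset κ) (p : ι → K[X]) (q : κ → K[X]) (m : ι → M) (m' : κ → M)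
    (h : ∀ k : ℕ, ∑ i ∈ s, (p i).eval (k : K) • m i = ∑ j ∈ t, (q j).eval (k : K) • m' j) :
    ∑ i ∈ s, (derivative (p i)).eval 0 • m i = ∑ j ∈ t, (derivative (q j)).eval 0 • m' j := by
  rw [← sub_eq_zero, ← Module.forall_dual_apply_eq_zero_iff K]
  intro φ
  have h1 : ∑ i ∈ s, C (φ (m i)) * p i = ∑ j ∈ t, C (φ (m' j)) * q j := by
    refine eq_of_infinite_eval_eq _ _ ((Set.infinite_range_of_injective
      (Nat.cast_injective (R := K))).mono ?_)
    rintro _ ⟨k, rfl⟩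
    have := congrArg φ (h k)
    simp only [map_sum, map_smul, smul_eq_mul] at this
    simpa [eval_finsetSum, mul_comm] using this
  have h2 := congrArg (fun r => (derivative r).eval 0) h1
  simp only [derivative_sum, derivative_C_mul, eval_finsetSum, eval_mul, eval_C] at h2
  simp only [map_sub, map_sum, map_smul, smul_eq_mul]
  rw [sub_eq_zero]
  simpa only [mul_comm] using h2

variable (K) in
/-- The binomial coefficient `X (X - 1) ⋯ (X - j + 1) / j!` as a polynomial. -/
def binomial (j : ℕ) : K[X] := C ((j.factorial : K)⁻¹) * descPochhammer K j

theorem binomial_eval_natCast [CharZero K] (j k : ℕ) : (binomial K j).eval (k : K) = (k.choose j : K) := by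
  rw [binomial, eval_mul, eval_C, descPochhammer_eval_eq_descFactorial,
    Nat.descFactorial_eq_factorial_mul_choose, Nat.cast_mul,
    inv_mul_cancel_left₀ (Nat.cast_ne_zero.mpr j.factorial_ne_zero)]

theorem binomial_eval_zero [CharZero K] (j : ℕ) : (binomial K j).eval 0 = if j = 0 then 1 else 0 := by
  have := binomial_eval_natCast (K := K) j 0
  rw [Nat.cast_zero] at this
  rw [this]
  cases j <;> simp

theorem descPochhammer_eval_neg_one (j : ℕ) :
    (descPochhammer K j).eval (-1) = (-1) ^ j * j.factorial := by
  induction j with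
  | zero => simp
  | succ j ih =>
    rw [descPochhammer_succ_eval, ih, Nat.factorial_succ, Nat.cast_mul, Nat.cast_succ, pow_succ]
    ring

/-- These are the coefficients of log(1 + a), the derivative at t = 0 of (1 + a)^t = ∑ binom(t, j)
a^j. -/
theorem derivative_binomial_eval_zero [CharZero K] (j : ℕ) :
    (derivative (binomial K j)).eval 0 = if j = 0 then 0 else (-1) ^ (j + 1) / (j : K) := by
  cases j with
  | zero => simp [binomial]
  | succ j =>
    have h : (j.factorial : K) ≠ 0 := Nat.cast_ne_zero.mpr j.factorial_ne_zero
    have h' : (j : K) + 1 ≠ 0 := Nat.cast_add_one_ne_zero j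
    rw [binomial, derivative_C_mul, descPochhammer_succ_left, derivative_mul, derivative_X,
      one_mul, eval_mul, eval_C, eval_add, eval_mul, eval_X, zero_mul, add_zero, eval_comp,
      eval_sub, eval_X, eval_one, zero_sub, descPochhammer_eval_neg_one, if_neg j.succ_ne_zero,
      Nat.factorial_succ, Nat.cast_mul, Nat.cast_succ]
    field_simp
    ring

end Polynomial

section NilpotentLog

variable {K A : Type*} [Field K] [Ring A] [Algebra K A]

variable (K) in
theorem one_add_pow_of_pow_eq_zero {a : A} {n : ℕ} (ha : a ^ n = 0) (k : ℕ) :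
    (1 + a) ^ k = ∑ j ∈ Finset.range n, (k.choose j : K) • a ^ j := by
  rw [add_comm, (Commute.one_right a).add_pow]
  have h1 : ∀ j, a ^ j * 1 ^ (k - j) * (k.choose j : A) = (k.choose j : K) • a ^ j := fun j => by
    rw [one_pow, mul_one, ← Nat.cast_comm, ← nsmul_eq_mul, Nat.cast_smul_eq_nsmul]
  simp only [h1]
  trans ∑ j ∈ Finset.range (n + k + 1), (k.choose j : K) • a ^ j
  · refine Finset.sum_subset (Finset.range_subset_range.mpr (by omega)) fun j _ hj => ?_
    rw [Nat.choose_eq_zero_of_lt (by simpa using hj), Nat.cast_zero, zero_smul]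
  · refine (Finset.sum_subset (Finset.range_subset_range.mpr (by omega)) fun j _ hj => ?_).symm
    rw [pow_eq_zero_of_le (by simpa using hj) ha, smul_zero]

open Polynomial in
/-- The logarithm of a product of commuting unipotent elements. -/
theorem sum_log_mul [CharZero K] {x y : A} (hxy : Commute x y) {n : ℕ} (hx : (x - 1) ^ n = 0)
    (hy : (y - 1) ^ n = 0) (h : (x * y - 1) ^ n = 0) :
    ∑ k ∈ Finset.Ico 1 n, ((-1) ^ (k + 1) / (k : K)) • (x * y - 1) ^ k =
      ∑ k ∈ Finset.Ico 1 n, ((-1) ^ (k + 1) / (k : K)) • (x - 1) ^ k +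
        ∑ k ∈ Finset.Ico 1 n, ((-1) ^ (k + 1) / (k : K)) • (y - 1) ^ k := by
  rcases n.eq_zero_or_pos with rfl | hn
  · simp
  have h0 : 0 ∈ Finset.range n := by simpa using hn
  have pow_eq : ∀ {z : A}, (z - 1) ^ n = 0 → ∀ k : ℕ,
      z ^ k = ∑ j ∈ Finset.range n, (binomial K j).eval (k : K) • (z - 1) ^ j := fun {z} hz k => by
    have := one_add_pow_of_pow_eq_zero K hz k
    simp only [binomial_eval_natCast]
    rwa [add_sub_cancel] at this
  have log_eq : ∀ z : A, ∑ j ∈ Finset.range n, (derivative (binomial K j)).eval 0 • (z - 1) ^ j =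
      ∑ k ∈ Finset.Ico 1 n, ((-1) ^ (k + 1) / (k : K)) • (z - 1) ^ k := fun z => by
    rw [Finset.range_eq_Ico, Finset.sum_eq_sum_Ico_succ_bot hn, derivative_binomial_eval_zero,
      if_pos rfl, zero_smul, zero_add]
    refine Finset.sum_congr rfl fun k hk => ?_
    rw [derivative_binomial_eval_zero, if_neg (by simp at hk; omega)]
  -- Differentiate (xy)^k = x^k y^k at k = 0, both sides being polynomial in k. In the product rule
  -- below, binom(0, j) vanishes unless j = 0, which leaves the two separate logarithms.
  have key := sum_derivative_eval_zero_smul (K := K) (Finset.range n)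
    (Finset.range n ×ˢ Finset.range n) (binomial K) (fun i => binomial K i.1 * binomial K i.2)
    (fun j => (x * y - 1) ^ j) (fun i => (x - 1) ^ i.1 * (y - 1) ^ i.2) fun k => by
      rw [← pow_eq h, hxy.mul_pow, pow_eq hx, pow_eq hy, Finset.sum_mul_sum, Finset.sum_product]
      simp only [eval_mul, smul_mul_smul_comm]
  rw [← log_eq, ← log_eq, ← log_eq, key, Finset.sum_product]
  simp only [derivative_mul, eval_add, eval_mul, add_smul, Finset.sum_add_distrib,
    binomial_eval_zero, mul_ite, ite_mul, mul_one, one_mul, mul_zero, zero_mul, ite_smul, zero_smul]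
  congr 1
  · refine Finset.sum_congr rfl fun i _ => ?_
    rw [Finset.sum_ite_eq' , if_pos h0, pow_zero, mul_one]
  · rw [Finset.sum_comm]
    refine Finset.sum_congr rfl fun i _ => ?_
    rw [Finset.sum_ite_eq', if_pos h0, pow_zero, one_mul]

end NilpotentLog

namespace AlgFiltration

variable {K A : Type*} [Field K] [CharZero K] [Ring A] [Algebra K A] (Θ : AlgFiltration K A)

/-- After f, x ⊗ x is the product of the commuting elements x ⊗ 1 and 1 ⊗ x, and all three are
unipotent of order n since f kills F_n. -/
theorem map_sum_log_tmul {B : Type*} [Ring B] [Algebra K B] {n : ℕ} (f : A ⊗[K] A →ₐ[K] B)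
    (hf : ∀ w ∈ (Θ.tensor Θ).F n, f w = 0) {x : A} (hx : x - 1 ∈ Θ.F 1) :
    f (∑ k ∈ Finset.Ico 1 n, ((-1) ^ (k + 1) / (k : K)) • (x ⊗ₜ[K] x - 1) ^ k) =
      f ((∑ k ∈ Finset.Ico 1 n, ((-1) ^ (k + 1) / (k : K)) • (x - 1) ^ k) ⊗ₜ 1) +
        f (1 ⊗ₜ (∑ k ∈ Finset.Ico 1 n, ((-1) ^ (k + 1) / (k : K)) • (x - 1) ^ k)) := by
  let left : A →ₐ[K] B := f.comp Algebra.TensorProduct.includeLeft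
  let right : A →ₐ[K] B := f.comp Algebra.TensorProduct.includeRight
  have hleft : ∀ z, f (z ⊗ₜ 1) = left z := fun _ => rfl
  have hright : ∀ z, f (1 ⊗ₜ z) = right z := fun _ => rfl
  have hxx : f (x ⊗ₜ x) = left x * right x := by
    rw [← hleft, ← hright, ← map_mul, Algebra.TensorProduct.tmul_mul_tmul, one_mul, mul_one]
  have hcomm : Commute (left x) (right x) := by
    rw [Commute, SemiconjBy, ← hxx, ← hleft, ← hright, ← map_mul,
      Algebra.TensorProduct.tmul_mul_tmul, one_mul, mul_one]
  have top : ∀ a, a ∈ Θ.F 0 := fun a => by rw [Θ.zero]; trivial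
  have h1 : (left x - 1) ^ n = 0 := by
    have e : (left x - 1) ^ n = left ((x - 1) ^ n) := by simp only [map_pow, map_sub, map_one]
    rw [e, ← hleft]
    have := Θ.tmul_mem Θ (Θ.pow_mem hx n) (top 1)
    rw [add_zero] at this
    exact hf _ this
  have h2 : (right x - 1) ^ n = 0 := by
    have e : (right x - 1) ^ n = right ((x - 1) ^ n) := by simp only [map_pow, map_sub, map_one]
    rw [e, ← hright]
    have := Θ.tmul_mem Θ (top 1) (Θ.pow_mem hx n)
    rw [zero_add] at this
    exact hf _ this
  have h3 : (left x * right x - 1) ^ n = 0 := by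
    have e : x ⊗ₜ[K] x - 1 = (x - 1) ⊗ₜ x + 1 ⊗ₜ (x - 1) := by
      rw [TensorProduct.sub_tmul, TensorProduct.tmul_sub, Algebra.TensorProduct.one_def]; abel
    have h4 := Θ.tmul_mem Θ hx (top x)
    have h5 := Θ.tmul_mem Θ (top 1) hx
    rw [zero_add] at h5
    rw [add_zero] at h4
    have h7 := add_mem h4 h5
    rw [← e] at h7
    have h6 := hf _ ((Θ.tensor Θ).pow_mem h7 n)
    rwa [map_pow, map_sub, map_one, hxx] at h6
  rw [hleft, hright]
  simp only [map_sum, map_smul, map_pow, map_sub, map_one, hxx]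
  exact sum_log_mul hcomm h1 h2 h3

/-- The partial sums of the logarithm of `x ⊗ x` are primitive modulo the filtration. -/
theorem sum_log_tmul_sub_mem {x : A} (hx : x - 1 ∈ Θ.F 1) (n : ℕ) :
    ∑ k ∈ Finset.Ico 1 n, ((-1) ^ (k + 1) / (k : K)) • (x ⊗ₜ[K] x - 1) ^ k -
      ((∑ k ∈ Finset.Ico 1 n, ((-1) ^ (k + 1) / (k : K)) • (x - 1) ^ k) ⊗ₜ 1 +
        1 ⊗ₜ (∑ k ∈ Finset.Ico 1 n, ((-1) ^ (k + 1) / (k : K)) • (x - 1) ^ k)) ∈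
      (Θ.tensor Θ).F n := by
  have key := Θ.map_sum_log_tmul (Ideal.Quotient.mkₐ K ((Θ.tensor Θ).ideal n))
    (fun w hw => Ideal.Quotient.eq_zero_iff_mem.mpr hw) hx
  rw [← map_add] at key
  exact Ideal.Quotient.eq.mp key

end AlgFiltration

namespace GroupFiltration

variable (K : Type*) [Field K] {G : Type*} [Group G] (Φ : GroupFiltration G)

/-- Checked modulo each F_n, where log ι(g) is represented by a truncated logarithm `a` in K[G]; the
error of truncation contributes only elements of F_n in the tensor square. -/
theorem logι_mem_malcevLie [CharZero K] (g : G) : Φ.logι K g ∈ Φ.malcevLie K := by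
  rw [mem_malcevLie]
  refine AlgFiltration.completion_ext _ fun n => ?_
  have h1 : Φ.ι K g - 1 ∈ (Φ.groupAlgebra K).completed.F 1 :=
    Φ.ι_sub_one_mem K (k := 1) (by rw [Φ.one]; trivial)
  have top : (1 : Φ.CompletedGroupAlgebra K) ∈ (Φ.groupAlgebra K).completed.F 0 := by
    rw [AlgFiltration.zero]; trivial
  have hS := (Φ.groupAlgebra K).log_sub_mem (Φ.ι K g) h1 n
  have key := (Φ.groupAlgebra K).completed.sum_log_tmul_sub_mem h1 n
  let a : MonoidAlgebra K G :=
    ∑ k ∈ Finset.Ico 1 n, ((-1) ^ (k + 1) / (k : K)) • (MonoidAlgebra.of K G g - 1) ^ k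
  have ha : (Φ.groupAlgebra K).toCompletion a =
      ∑ k ∈ Finset.Ico 1 n, ((-1) ^ (k + 1) / (k : K)) • (Φ.ι K g - 1) ^ k := by
    simp only [a, map_sum, map_smul, map_pow, map_sub, map_one]
    rfl
  have ha' : Φ.preComul K a =
      ∑ k ∈ Finset.Ico 1 n, ((-1) ^ (k + 1) / (k : K)) • (Φ.ι K g ⊗ₜ[K] Φ.ι K g - 1) ^ k := by
    simp only [a, map_sum, map_smul, map_pow, map_sub, map_one, preComul_of]
  rw [← ha', ← ha] at key
  rw [← ha] at hS
  change Φ.logι K g - _ ∈ _ at hS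
  have hproj : (Φ.groupAlgebra K).proj n (Φ.logι K g) = Ideal.Quotient.mk _ a := by
    have h2 : (Φ.groupAlgebra K).proj n (Φ.logι K g - (Φ.groupAlgebra K).toCompletion a) = 0 := hS
    rw [map_sub, sub_eq_zero] at h2
    exact h2
  have hlhs : AlgFiltration.proj _ n (Φ.completeComul K (Φ.logι K g)) =
      Ideal.Quotient.mk _ (Φ.preComul K a) := AlgFiltration.proj_map _ _ hproj
  have hrhs : AlgFiltration.proj _ n
      (Φ.completeTmul K (Φ.logι K g) 1 + Φ.completeTmul K 1 (Φ.logι K g)) =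
      Ideal.Quotient.mk _ (Φ.logι K g ⊗ₜ[K] 1 + 1 ⊗ₜ[K] Φ.logι K g) := rfl
  rw [hlhs, hrhs, Ideal.Quotient.eq]
  have h3 := AlgFiltration.tmul_mem _ (Φ.groupAlgebra K).completed hS top
  have h4 := AlgFiltration.tmul_mem (Φ.groupAlgebra K).completed _ top hS
  rw [zero_add, TensorProduct.tmul_sub] at h4
  rw [add_zero, TensorProduct.sub_tmul] at h3
  have h5 := sub_mem (sub_mem key h3) h4
  rw [AlgFiltration.mem_ideal]
  convert h5 using 1
  abel

/-- The terms with k ≥ 2 lie in F_{2i}, which is contained in F_{i+1} because i ≥ 1. -/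
theorem logι_sub_mem {i : ℕ+} {g : G} (hg : g ∈ Φ.F i) :
    Φ.logι K g - (Φ.ι K g - 1) ∈ (Φ.groupAlgebra K).completed.F (i + 1) := by
  set Θ := (Φ.groupAlgebra K).completed
  have h1 : Φ.logι K g - _ ∈ Θ.F (i + 1) := (Φ.groupAlgebra K).log_sub_mem _ _ (i + 1)
  have hi : 1 < (i : ℕ) + 1 := by have := i.pos; omega
  rw [Finset.sum_eq_sum_Ico_succ_bot hi] at h1
  have h2 : ∑ k ∈ Finset.Ico 2 ((i : ℕ) + 1), ((-1) ^ (k + 1) / (k : K)) • (Φ.ι K g - 1) ^ k ∈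
      Θ.F (i + 1) := by
    refine sum_mem fun k hk => Submodule.smul_mem _ _ ?_
    obtain ⟨k, rfl⟩ := Nat.exists_eq_add_of_le (Finset.mem_Ico.mp hk).1
    have h3 := Φ.ι_sub_one_mem K hg
    have h4 := Θ.mul_mem (Θ.mul_mem h3 h3) (b := (Φ.ι K g - 1) ^ k) (j := 0)
      (by rw [AlgFiltration.zero]; trivial)
    rw [← pow_two, ← pow_add] at h4
    exact Θ.antitone (by omega) h4
  have h5 := add_mem h1 h2
  norm_num at h5
  rwa [sub_add_eq_sub_sub, sub_add_cancel] at h5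

theorem logι_mem {i : ℕ+} {g : G} (hg : g ∈ Φ.F i) :
    Φ.logι K g ∈ (Φ.groupAlgebra K).completed.F i := by
  have := add_mem ((Φ.groupAlgebra K).completed.antitone (Nat.le_succ i) (Φ.logι_sub_mem K hg))
    (Φ.ι_sub_one_mem K hg)
  rwa [sub_add_cancel] at this

end GroupFiltration

end

/-! ### Comparison of the associated graded Lie algebras -/

noncomputable section

theorem AlgFiltration.toCompletion_mem_iff {K A : Type*} [CommRing K] [Ring A] [Algebra K A]
    (Θ : AlgFiltration K A) {n : ℕ} {a : A} : Θ.toCompletion a ∈ Θ.completed.F n ↔ a ∈ Θ.F n :=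
  Ideal.Quotient.eq_zero_iff_mem

theorem lie_sub_lie_identity {A : Type*} [Ring A] {a b c m x y z : A}
    (h : a * b - b * a = c + c * m) : z - (x * y - y * x) =
      z - c - (x * (y - b) - (y - b) * x + ((x - a) * b - b * (x - a))) - c * m := by
  have e : z - c - (x * (y - b) - (y - b) * x + ((x - a) * b - b * (x - a))) - c * m =
      z - (x * y - y * x) + (a * b - b * a - (c + c * m)) := by noncomm_ring
  rw [e, h, sub_self, add_zero]

namespace GroupFiltration

variable (K : Type*) [Field K] {G : Type*} [Group G] (Φ : GroupFiltration G)

theorem malcevCls_eq {i : ℕ+} {x y : Φ.malcevLie K} {hx : x ∈ (Φ.malcevFiltration K).F i}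
    {hy : y ∈ (Φ.malcevFiltration K).F i}
    (h : (x : Φ.CompletedGroupAlgebra K) - y ∈ (Φ.groupAlgebra K).completed.F (i + 1)) :
    (Φ.malcevFiltration K).cls i x hx = (Φ.malcevFiltration K).cls i y hy :=
  (Submodule.Quotient.eq _).mpr h

/-- From gh − 1 = (g − 1) + (h − 1) + (g − 1)(h − 1), with last term in F_{2i}. -/
theorem logι_mul_sub_mem {i : ℕ+} {g h : G} (hg : g ∈ Φ.F i) (hh : h ∈ Φ.F i) :
    Φ.logι K (g * h) - (Φ.logι K g + Φ.logι K h) ∈ (Φ.groupAlgebra K).completed.F (i + 1) := by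
  have h1 := Φ.logι_sub_mem K (mul_mem hg hh)
  have h2 := Φ.logι_sub_mem K hg
  have h3 := Φ.logι_sub_mem K hh
  have h4 := (Φ.groupAlgebra K).completed.antitone
    (by have := i.pos; omega : (i : ℕ) + 1 ≤ i + i)
    ((Φ.groupAlgebra K).completed.mul_mem (Φ.ι_sub_one_mem K hg) (Φ.ι_sub_one_mem K hh))
  have h5 := add_mem (sub_mem (sub_mem h1 h2) h3) h4
  rw [map_mul] at h5
  convert h5 using 1
  noncomm_ring

/-- The logarithms may be replaced by g − 1 and h − 1 up to F_{i+j+1}, and there [g − 1, h − 1] ≡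
[g,h] − 1. -/
theorem logι_commutator_sub_mem {i j : ℕ+} {g h : G} (hg : g ∈ Φ.F i) (hh : h ∈ Φ.F j) :
    Φ.logι K ⁅g, h⁆ - (Φ.logι K g * Φ.logι K h - Φ.logι K h * Φ.logι K g) ∈
      (Φ.groupAlgebra K).completed.F (i + j + 1) := by
  have h1 := Φ.logι_sub_mem K (Φ.comm_mem hg hh)
  have h2 := Φ.logι_sub_mem K hg
  have h3 := Φ.logι_sub_mem K hh
  have a1 := Φ.ι_sub_one_mem K hg
  have b1 := Φ.ι_sub_one_mem K hh
  have g1 := Φ.logι_mem K hg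
  have c1 := Φ.ι_sub_one_mem K (Φ.comm_mem hg hh)
  have m1 := Φ.ι_sub_one_mem K (k := 1) (g := h * g) (by rw [Φ.one]; trivial)
  rw [PNat.add_coe] at h1 c1
  rw [PNat.one_coe] at m1
  have e1 : Φ.ι K ⁅g, h⁆ * Φ.ι K (h * g) = Φ.ι K g * Φ.ι K h := by
    rw [← map_mul, ← map_mul]
    congr 1
    simp [commutatorElement_def, mul_assoc]
  have e2 := commutator_sub_one_identity e1 (map_mul _ _ _)
  generalize (Φ.groupAlgebra K).completed = Θ at *
  have h4 := Θ.mul_mem g1 h3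
  have h5 := Θ.mul_mem h3 g1
  have h6 := Θ.mul_mem h2 b1
  have h7 := Θ.mul_mem b1 h2
  have h8 := Θ.mul_mem c1 m1
  rw [← add_assoc] at h4 h7
  rw [add_comm, ← add_assoc] at h5
  rw [add_right_comm] at h6
  rw [add_comm (j : ℕ) (i : ℕ)] at h7
  have := sub_mem (sub_mem h1 (add_mem (sub_mem h4 h5) (sub_mem h6 h7))) h8
  rwa [← lie_sub_lie_identity e2] at this

/-- The embedding of `F_i m(G) / F_{i+1} m(G)` in the quotient of the completed group algebra by
`F_{i+1}`. -/
def pieceEmb (i : ℕ+) : (Φ.malcevFiltration K).Piece i →ₗ[K]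
    Φ.CompletedGroupAlgebra K ⧸ (Φ.groupAlgebra K).completed.F (i + 1) :=
  Submodule.mapQ _ _ ((Φ.malcevLie K).toSubmodule.subtype.comp
    ((Φ.malcevFiltration K).F i).subtype) fun _ h => h

theorem pieceEmb_cls {i : ℕ+} {x : Φ.malcevLie K} (hx : x ∈ (Φ.malcevFiltration K).F i) :
    Φ.pieceEmb K i ((Φ.malcevFiltration K).cls i x hx) =
      Submodule.Quotient.mk (x : Φ.CompletedGroupAlgebra K) := rfl

theorem pieceEmb_injective (i : ℕ+) : Function.Injective (Φ.pieceEmb K i) := by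
  intro p q h
  obtain ⟨x, hx, rfl⟩ := (Φ.malcevFiltration K).cls_surj p
  obtain ⟨y, hy, rfl⟩ := (Φ.malcevFiltration K).cls_surj q
  rw [pieceEmb_cls, pieceEmb_cls, Submodule.Quotient.eq] at h
  exact Φ.malcevCls_eq K h

/-- Primitivity is given in the complete tensor square; strictness of the filtration of K[G] ⊗ K[G]
turns it into a congruence for a representative in K[G]. -/
theorem comul_sub_mem_of_malcevLie {n : ℕ} {x : Φ.CompletedGroupAlgebra K}
    (hx : x ∈ Φ.malcevLie K) {a : MonoidAlgebra K G}
    (ha : (Φ.groupAlgebra K).proj n x = Ideal.Quotient.mk _ a) :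
    Bialgebra.comulAlgHom K _ a - (a ⊗ₜ[K] 1 + 1 ⊗ₜ[K] a) ∈
      ((Φ.groupAlgebra K).tensor (Φ.groupAlgebra K)).F n := by
  have hxa : x - (Φ.groupAlgebra K).toCompletion a ∈ (Φ.groupAlgebra K).completed.F n := by
    rw [AlgFiltration.mem_completed, map_sub, ha]
    exact sub_self _
  have top : (1 : Φ.CompletedGroupAlgebra K) ∈ (Φ.groupAlgebra K).completed.F 0 := by
    rw [AlgFiltration.zero]; trivial
  refine AlgFiltration.mem_tensor_of_map_toCompletion _ ?_
  have h1 := congrArg (AlgFiltration.proj _ n) ((Φ.mem_malcevLie K).mp hx)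
  have h2 : AlgFiltration.proj _ n (Φ.completeComul K x) =
      Ideal.Quotient.mk _ (Φ.preComul K a) := AlgFiltration.proj_map _ _ ha
  have h3 : AlgFiltration.proj _ n (Φ.completeTmul K x 1 + Φ.completeTmul K 1 x) =
      Ideal.Quotient.mk _ (x ⊗ₜ[K] 1 + 1 ⊗ₜ[K] x) := rfl
  rw [h2, h3, Ideal.Quotient.eq, AlgFiltration.mem_ideal] at h1
  have h4 := AlgFiltration.tmul_mem _ (Φ.groupAlgebra K).completed hxa top
  have h5 := AlgFiltration.tmul_mem (Φ.groupAlgebra K).completed _ top hxa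
  rw [zero_add, TensorProduct.tmul_sub] at h5
  rw [add_zero, TensorProduct.sub_tmul] at h4
  have h6 := add_mem (add_mem h1 h4) h5
  rw [map_sub, map_add, Algebra.TensorProduct.map_tmul, Algebra.TensorProduct.map_tmul, map_one]
  convert h6 using 1
  change Φ.preComul K a - _ = _
  abel

theorem Gr.induction {motive : Φ.Gr → Prop} (zero : motive 0)
    (homogeneous : ∀ i p, motive (Φ.homogeneous i p))
    (add : ∀ x y, motive x → motive y → motive (x + y)) (x : Φ.Gr) : motive x :=
  DirectSum.induction_on (motive := motive) x zero homogeneous add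

variable [CharZero K]

/-- `log (ι g)` as an element of the Malcev Lie algebra. -/
def malcevLog (g : G) : Φ.malcevLie K := ⟨Φ.logι K g, Φ.logι_mem_malcevLie K g⟩

theorem malcevLog_mem {i : ℕ+} {g : G} (hg : g ∈ Φ.F i) :
    Φ.malcevLog K g ∈ (Φ.malcevFiltration K).F i := Φ.logι_mem K hg

/-- The map `F_i G → F_i m(G) / F_{i+1} m(G)` induced by `log ι`. -/
def clsLog (i : ℕ+) : Φ.F i →* Multiplicative ((Φ.malcevFiltration K).Piece i) :=
  MonoidHom.mk' (fun g => Multiplicative.ofAdd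
    ((Φ.malcevFiltration K).cls i (Φ.malcevLog K g) (Φ.malcevLog_mem K g.2))) fun g h => by
      rw [← ofAdd_add, LieFiltration.cls_add]
      exact congrArg _ (Φ.malcevCls_eq K (Φ.logι_mul_sub_mem K g.2 h.2))

theorem clsLog_eq_one {i : ℕ+} {g : Φ.F i} (hg : (g : G) ∈ Φ.F (i + 1)) : Φ.clsLog K i g = 1 :=
  congrArg Multiplicative.ofAdd
    ((Submodule.Quotient.mk_eq_zero _).mpr (Φ.malcevLog_mem K (i := i + 1) hg))

/-- The map `F_i G / F_{i+1} G → F_i m(G) / F_{i+1} m(G)` induced by `log ι`. -/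
def pieceHom (i : ℕ+) : Φ.Piece i →+ (Φ.malcevFiltration K).Piece i :=
  MonoidHom.toAdditiveLeft <| QuotientGroup.lift _ (Φ.clsLog K i) fun _ hg => Φ.clsLog_eq_one K hg

theorem pieceHom_cls {i : ℕ+} {g : G} (hg : g ∈ Φ.F i) :
    Φ.pieceHom K i (Φ.cls i g hg) =
      (Φ.malcevFiltration K).cls i (Φ.malcevLog K g) (Φ.malcevLog_mem K hg) := rfl

/-- The degree `i` part of the map `K ⊗ Gr G → Gr m(G)`. -/
def pieceMap (i : ℕ+) : K ⊗[ℤ] Φ.Piece i →ₗ[K] (Φ.malcevFiltration K).Piece i :=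
  (Φ.pieceHom K i).toIntLinearMap.liftBaseChange K

theorem pieceMap_tmul {i : ℕ+} (c : K) (p : Φ.Piece i) :
    Φ.pieceMap K i (c ⊗ₜ p) = c • Φ.pieceHom K i p := by
  simp [pieceMap]

theorem pieceEmb_pieceMap_cls {i : ℕ+} {g : G} (hg : g ∈ Φ.F i) :
    Φ.pieceEmb K i (Φ.pieceMap K i (1 ⊗ₜ Φ.cls i g hg)) = Submodule.Quotient.mk
      ((Φ.groupAlgebra K).toCompletion (MonoidAlgebra.of K G g - 1)) := by
  rw [pieceMap_tmul, one_smul, pieceHom_cls, pieceEmb_cls, Submodule.Quotient.eq, map_sub, map_one]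
  exact Φ.logι_sub_mem K hg

/-- Expresses the degree i map through lifts to K[F_iG], where vanishing becomes membership of a −
ε(a) in F_{i+1}K[G]; subtracting ε(a) replaces each g by g − 1. -/
theorem pieceEmb_pieceMap_tmulCls (i : ℕ+) (a : MonoidAlgebra K (Φ.F i)) :
    Φ.pieceEmb K i (Φ.pieceMap K i (Φ.tmulCls K i a)) = Submodule.Quotient.mk
      ((Φ.groupAlgebra K).toCompletion (MonoidAlgebra.mapDomainAlgHom K K (Φ.F i).subtype a -
        algebraMap K _ (Bialgebra.counitAlgHom K (MonoidAlgebra K (Φ.F i)) a))) := by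
  induction a using MonoidAlgebra.induction_on with
  | of g =>
    have e : Bialgebra.counitAlgHom K _ (MonoidAlgebra.of K (Φ.F i) g) = 1 := by simp
    rw [tmulCls_of, pieceEmb_pieceMap_cls, mapDomainAlgHom_of, e, map_one]
    rfl
  | add a b ha hb =>
    rw [map_add, map_add, map_add, ha, hb, ← Submodule.Quotient.mk_add, ← map_add]
    congr 2
    simp only [map_add]
    abel
  | smul r a ha =>
    rw [map_smul, map_smul, map_smul, ha, ← Submodule.Quotient.mk_smul, ← map_smul]
    congr 2
    simp only [map_smul, smul_sub, smul_eq_mul, map_mul, ← Algebra.smul_def]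

theorem pieceMap_injective (i : ℕ+) : Function.Injective (Φ.pieceMap K i) := by
  rw [injective_iff_map_eq_zero]
  intro t ht
  obtain ⟨a, rfl⟩ := Φ.tmulCls_surjective K i t
  refine Φ.tmulCls_eq_zero K i ?_
  rw [← AlgFiltration.toCompletion_mem_iff, ← Submodule.Quotient.mk_eq_zero,
    ← pieceEmb_pieceMap_tmulCls, ht, map_zero]

theorem mk_mem_range_of_mem_lieSpan (i : ℕ+) {a : MonoidAlgebra K G} (ha : a ∈ Φ.lieSpan K i) :
    Submodule.Quotient.mk ((Φ.groupAlgebra K).toCompletion a) ∈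
      LinearMap.range ((Φ.pieceEmb K i).comp (Φ.pieceMap K i)) := by
  refine (sup_le (Submodule.span_le.mpr ?_) ?_ : Φ.lieSpan K i ≤
    (LinearMap.range ((Φ.pieceEmb K i).comp (Φ.pieceMap K i))).comap
      ((Submodule.mkQ _).comp (Φ.groupAlgebra K).toCompletion.toLinearMap)) ha
  · rintro _ ⟨k, hk, g, hg, rfl⟩
    obtain rfl := PNat.coe_injective hk
    exact ⟨1 ⊗ₜ Φ.cls k g hg, Φ.pieceEmb_pieceMap_cls K hg⟩
  · intro b hb
    refine ⟨0, ?_⟩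
    rw [map_zero]
    exact ((Submodule.Quotient.mk_eq_zero _).mpr ((Φ.groupAlgebra K).toCompletion_mem hb)).symm

/-- A representative modulo F_{i+1} of a primitive element of F_i is primitive modulo F_{i+1}, so
the Dynkin argument writes it through elements g − 1 with g in F_iG. -/
theorem pieceMap_surjective (i : ℕ+) : Function.Surjective (Φ.pieceMap K i) := by
  intro p
  obtain ⟨x, hx, rfl⟩ := (Φ.malcevFiltration K).cls_surj p
  obtain ⟨a, ha⟩ := (Φ.groupAlgebra K).exists_proj (i + 1) (x : Φ.CompletedGroupAlgebra K)
  have hx0 : (Φ.groupAlgebra K).proj i (x : Φ.CompletedGroupAlgebra K) = 0 := hx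
  have hai : a ∈ (Φ.groupAlgebra K).F i := by
    rw [ha i (Nat.le_succ i)] at hx0
    exact Ideal.Quotient.eq_zero_iff_mem.mp hx0
  obtain ⟨t, ht⟩ := Φ.mk_mem_range_of_mem_lieSpan K i (Φ.mem_lieSpan_of_primitive K i.ne_zero hai
    (Φ.comul_sub_mem_of_malcevLie K x.2 (ha _ le_rfl)))
  refine ⟨t, Φ.pieceEmb_injective K i (ht.trans ?_)⟩
  rw [pieceEmb_cls, eq_comm, Submodule.Quotient.eq, AlgFiltration.mem_completed, map_sub,
    ha _ le_rfl]
  exact sub_self _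

/-- The degree `i` part of the isomorphism `K ⊗ Gr G ≃ Gr m(G)`. -/
def pieceEquiv (i : ℕ+) : K ⊗[ℤ] Φ.Piece i ≃ₗ[K] (Φ.malcevFiltration K).Piece i :=
  LinearEquiv.ofBijective _ ⟨Φ.pieceMap_injective K i, Φ.pieceMap_surjective K i⟩

/-- The linear isomorphism `K ⊗ Gr G ≃ Gr m(G)`. -/
def grEquiv : K ⊗[ℤ] Φ.Gr ≃ₗ[K] (Φ.malcevFiltration K).Gr :=
  (TensorProduct.directSumRight ℤ K K Φ.Piece).trans
    (DFinsupp.mapRange.linearEquiv (Φ.pieceEquiv K))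

theorem grEquiv_tmul_homogeneous {i : ℕ+} (c : K) (p : Φ.Piece i) :
    Φ.grEquiv K (c ⊗ₜ Φ.homogeneous i p) =
      (Φ.malcevFiltration K).homogeneous i (Φ.pieceMap K i (c ⊗ₜ p)) := by
  have h : TensorProduct.directSumRight ℤ K K Φ.Piece (c ⊗ₜ DirectSum.lof ℤ _ _ i p) =
      DirectSum.lof K _ _ i (c ⊗ₜ p) := TensorProduct.directSumRight_tmul_lof ℤ K c i p
  refine (congrArg (DFinsupp.mapRange.linearEquiv (Φ.pieceEquiv K)) h).trans ?_
  exact DFinsupp.mapRange_single (hf := fun i => map_zero (Φ.pieceEquiv K i))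

theorem grEquiv_lie_homogeneous {i j : ℕ+} (c d : K) (p : Φ.Piece i) (q : Φ.Piece j) :
    Φ.grEquiv K ⁅c ⊗ₜ[ℤ] Φ.homogeneous i p, d ⊗ₜ[ℤ] Φ.homogeneous j q⁆ =
      ⁅Φ.grEquiv K (c ⊗ₜ Φ.homogeneous i p), Φ.grEquiv K (d ⊗ₜ Φ.homogeneous j q)⁆ := by
  obtain ⟨g, hg, rfl⟩ := Φ.cls_surj p
  obtain ⟨h, hh, rfl⟩ := Φ.cls_surj q
  rw [LieAlgebra.ExtendScalars.bracket_tmul, lie_homogeneous, grEquiv_tmul_homogeneous,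
    grEquiv_tmul_homogeneous, grEquiv_tmul_homogeneous, pieceMap_tmul, pieceMap_tmul, pieceMap_tmul,
    map_smul, map_smul, map_smul, smul_lie, lie_smul, smul_smul, pieceHom_cls, pieceHom_cls,
    pieceHom_cls, LieFiltration.lie_homogeneous]
  congr 2
  exact Φ.malcevCls_eq K (Φ.logι_commutator_sub_mem K hg hh)

theorem grEquiv_lie (x y : K ⊗[ℤ] Φ.Gr) :
    Φ.grEquiv K ⁅x, y⁆ = ⁅Φ.grEquiv K x, Φ.grEquiv K y⁆ := by
  induction x with
  | zero => simp
  | add x x' hx hx' => rw [add_lie, map_add, hx, hx', map_add, add_lie]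
  | tmul c u =>
    have hadd : ∀ (w y z : K ⊗[ℤ] Φ.Gr), ⁅w, y + z⁆ = ⁅w, y⁆ + ⁅w, z⁆ := fun w y z => lie_add w y z
    induction y with
    | zero =>
      have h0 : ⁅c ⊗ₜ[ℤ] u, (0 : K ⊗[ℤ] Φ.Gr)⁆ = 0 := lie_zero (c ⊗ₜ[ℤ] u)
      rw [h0, map_zero, lie_zero]
    | add y y' hy hy' => rw [hadd, map_add, hy, hy', map_add, lie_add]
    | tmul d v =>
      induction u using Gr.induction with
      | zero => simp
      | add u u' hu hu' => rw [TensorProduct.tmul_add, add_lie, map_add, hu, hu', map_add, add_lie]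
      | homogeneous i p =>
        induction v using Gr.induction with
        | zero =>
          have h0 : ⁅c ⊗ₜ[ℤ] Φ.homogeneous i p, (0 : K ⊗[ℤ] Φ.Gr)⁆ = 0 :=
            lie_zero (c ⊗ₜ[ℤ] Φ.homogeneous i p)
          rw [TensorProduct.tmul_zero, h0, map_zero, lie_zero]
        | add v v' hv hv' =>
          rw [TensorProduct.tmul_add, hadd, map_add, hv, hv', map_add, lie_add]
        | homogeneous j q => exact Φ.grEquiv_lie_homogeneous K c d p q

/-- The isomorphism of Lie algebras `K ⊗ Gr G ≃ Gr m(G)`. -/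
def grLieEquiv : K ⊗[ℤ] Φ.Gr ≃ₗ⁅K⁆ (Φ.malcevFiltration K).Gr :=
  { Φ.grEquiv K with map_lie' := fun {x y} => Φ.grEquiv_lie K x y }

theorem grLieEquiv_map_scalarGrPart (i : ℕ+) :
    (Φ.scalarGrPart K i).map (Φ.grLieEquiv K : K ⊗[ℤ] Φ.Gr →ₗ[K] (Φ.malcevFiltration K).Gr) =
      LinearMap.range ((Φ.malcevFiltration K).homogeneous i) := by
  have h : (Φ.grLieEquiv K : K ⊗[ℤ] Φ.Gr →ₗ[K] (Φ.malcevFiltration K).Gr).comp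
      ((Φ.homogeneous i).toIntLinearMap.baseChange K) =
        ((Φ.malcevFiltration K).homogeneous i).comp (Φ.pieceMap K i) := by
    refine LinearMap.ext fun t => ?_
    induction t with
    | zero => simp
    | add s t hs ht => rw [map_add, map_add, hs, ht]
    | tmul c p => exact Φ.grEquiv_tmul_homogeneous K c p
  rw [scalarGrPart, ← LinearMap.range_comp, h, LinearMap.range_comp_of_range_eq_top]
  exact LinearMap.range_eq_top.mpr (Φ.pieceMap_surjective K i)

end GroupFiltration

end

theorem theoremA8 {K : Type*} [Field K] [CharZero K] {G : Type*} [Group G]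
    (Φ : GroupFiltration G) :
    ∃ (hP : ∀ g : G, Φ.logι K g ∈ Φ.malcevLie K)
      (hF : ∀ (i : ℕ+) (g : G), g ∈ Φ.F i → ⟨Φ.logι K g, hP g⟩ ∈ (Φ.malcevFiltration K).F i)
      (e : K ⊗[ℤ] Φ.Gr ≃ₗ⁅K⁆ (Φ.malcevFiltration K).Gr),
      (∀ i : ℕ+, (Φ.scalarGrPart K i).map (e : K ⊗[ℤ] Φ.Gr →ₗ[K] (Φ.malcevFiltration K).Gr) =
        LinearMap.range ((Φ.malcevFiltration K).homogeneous i)) ∧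
      ∀ (i : ℕ+) (g : G) (hg : g ∈ Φ.F i),
        e (1 ⊗ₜ[ℤ] Φ.homogeneous i (Φ.cls i g hg)) =
          (Φ.malcevFiltration K).homogeneous i
            ((Φ.malcevFiltration K).cls i ⟨Φ.logι K g, hP g⟩ (hF i g hg)) := by
  refine ⟨Φ.logι_mem_malcevLie K, fun i g hg => Φ.malcevLog_mem K hg, Φ.grLieEquiv K,
    Φ.grLieEquiv_map_scalarGrPart K, fun i g hg => ?_⟩
  refine (Φ.grEquiv_tmul_homogeneous K 1 _).trans ?_
  rw [Φ.pieceMap_tmul K, one_smul, Φ.pieceHom_cls K]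
  rfl
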